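/- Let $1\le p<\infty$, $p\ne 2$, and let $H^p$ be the Hardy space of the open unit disc $D$, i.e. the analytic $f:D\to\mathbb C$ with $\|f\|_p=\sup_{0<r<1}\bigl(\int_{T}|f(r\zeta)|^p\,dm(\zeta)\bigr)^{1/p}<\infty$, where $m$ is normalized Lebesgue measure on the unit circle $T$. Let $\mathbb A$ be the set of automorphisms $\phi(z)=\lambda\frac{z-a}{1-\bar a z}$ of $D$ ($|\lambda|=1$, $a\in D$); for such $\phi$ put $U_\phi f=(\bar\lambda\phi')^{1/p}\,(f\circ\phi)$ (principal branch of the power), and for $\psi\in\mathbb A$ let $M_\psi$ be multiplication by $\psi$. An automorphism is elliptic if it is not the identity and has a fixed point in $D$. A bounded linear operator $S$ on $H^p$ is Crownover if it is an isometry whose range has codimension one and $\bigcap_{n=1}^\infty S^nH^p=\{0\}$. If $\phi\in\mathbb A$ is elliptic and $\psi\in\mathbb A$, then $M_\psi U_\phi$ is a bounded operator on $H^p$ and is Crownover. Moreover, writing $\phi_n$ for the $n$-fold composition of $\phi$ with itself ($\phi_0(z)=z$), each $\psi\circ\phi_n$, $n\ge 0$, has exactly one zero $a_n$ in $D$; there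 is a circle that is contained, together with its interior, in $D$ and contains all the $a_n$; and $\sum_{n\ge0}(1-|a_n|)=\infty$, i.e. $(a_n)$ is not a Blaschke sequence. -/

import Mathlib

open Metric Set Function
open scoped Complex.UnitDisc ComplexConjugate Real

noncomputable section

/-! ### Automorphisms of the unit disc -/

/-- A holomorphic automorphism of the unit disc, `z ↦ lam * (z - a) / (1 - conj a * z)` with
`|lam| = 1` and `|a| < 1`. The parameters `lam` and `a` are determined by the map. -/
structure DiscAut where
  /-- the unimodular factor -/
  lam : ℂ
  /-- the zero of the automorphism -/
  a : ℂ
  norm_lam : ‖lam‖ = 1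
  norm_a : ‖a‖ < 1

namespace DiscAut

/-- The defining formula of the automorphism, as a function of a complex variable. -/
def formula (φ : DiscAut) (z : ℂ) : ℂ :=
  φ.lam * (z - φ.a) / (1 - conj φ.a * z)

theorem norm_formula_lt_one (φ : DiscAut) {z : ℂ} (hz : ‖z‖ < 1) : ‖φ.formula z‖ < 1 := by
  have ha := φ.norm_a
  have hne : 1 - conj φ.a * z ≠ 0 := by
    intro h
    have h1 : conj φ.a * z = 1 := (sub_eq_zero.mp h).symm
    have h2 : ‖φ.a‖ * ‖z‖ = 1 := by
      have := congrArg norm h1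
      simpa using this
    nlinarith [norm_nonneg φ.a, norm_nonneg z]
  have hpos : 0 < ‖1 - conj φ.a * z‖ := norm_pos_iff.mpr hne
  unfold formula
  rw [norm_div, norm_mul, φ.norm_lam, one_mul, div_lt_one hpos]
  have key : ‖1 - conj φ.a * z‖ ^ 2 - ‖z - φ.a‖ ^ 2 = (1 - ‖φ.a‖ ^ 2) * (1 - ‖z‖ ^ 2) := by
    simp only [← Complex.normSq_eq_norm_sq, Complex.normSq_apply, Complex.sub_re, Complex.sub_im,
      Complex.mul_re, Complex.mul_im, Complex.conj_re, Complex.conj_im, Complex.one_re,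
      Complex.one_im]
    ring
  have h1 : 0 < (1 - ‖φ.a‖ ^ 2) * (1 - ‖z‖ ^ 2) := by
    apply mul_pos
    · nlinarith [norm_nonneg φ.a]
    · nlinarith [norm_nonneg z]
  exact lt_of_pow_lt_pow_left₀ 2 hpos.le (by linarith)

/-- The automorphism as a self-map of the unit disc. -/
def toFun (φ : DiscAut) (z : 𝔻) : 𝔻 :=
  Complex.UnitDisc.mk (φ.formula z) (φ.norm_formula_lt_one z.norm_lt_one)

instance : CoeFun DiscAut (fun _ => 𝔻 → 𝔻) := ⟨toFun⟩

/-- `φ` is elliptic: it is not the identity and it has a fixed point in the open disc. -/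
def IsElliptic (φ : DiscAut) : Prop :=
  (φ : 𝔻 → 𝔻) ≠ id ∧ ∃ a : 𝔻, φ a = a

end DiscAut

/-! ### Hardy spaces -/

/-- Extension by zero of a function on the disc to the plane. -/
def discExtend (f : 𝔻 → ℂ) : ℂ → ℂ :=
  Function.extend ((↑) : 𝔻 → ℂ) f 0

/-- `f` is holomorphic on the disc. -/
def IsDiscHolomorphic (f : 𝔻 → ℂ) : Prop :=
  DifferentiableOn ℂ (discExtend f) (ball 0 1)

/-- The integral mean `(∫_T |f(r ζ)|^p dm(ζ))^(1/p)`, where `m` is normalized Lebesgue measure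
on the unit circle `T`. -/
def hardyMean (p : ℝ) (f : 𝔻 → ℂ) (r : ℝ) : ℝ :=
  (Real.circleAverage (fun z => ‖discExtend f z‖ ^ p) 0 r) ^ (1 / p)

theorem discExtend_coe (f : 𝔻 → ℂ) (z : 𝔻) : discExtend f z = f z :=
  Complex.UnitDisc.coe_injective.extend_apply f 0 z

theorem discExtend_add (f g : 𝔻 → ℂ) : discExtend (f + g) = discExtend f + discExtend g := by
  have := Function.extend_add ((↑) : 𝔻 → ℂ) f g 0 0
  simpa [discExtend] using this

theorem discExtend_smul (c : ℂ) (f : 𝔻 → ℂ) : discExtend (c • f) = c • discExtend f := by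
  have := Function.extend_smul c ((↑) : 𝔻 → ℂ) f 0
  simpa [discExtend] using this

theorem discExtend_zero : discExtend 0 = 0 := by
  simpa using discExtend_smul 0 0

theorem IsDiscHolomorphic.continuous_circle {f : 𝔻 → ℂ} (hf : IsDiscHolomorphic f) {r : ℝ}
    (hr : r ∈ Ioo (0 : ℝ) 1) : Continuous (fun θ : ℝ => discExtend f (circleMap 0 r θ)) := by
  refine ContinuousOn.comp_continuous hf.continuousOn (continuous_circleMap 0 r) ?_
  intro θ
  simp [abs_of_pos hr.1, hr.2]

theorem hardyMean_nonneg (p : ℝ) (f : 𝔻 → ℂ) (r : ℝ) : 0 ≤ hardyMean p f r := by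
  apply Real.rpow_nonneg
  exact Real.circleAverage_nonneg_of_nonneg fun x _ => by positivity

theorem IsDiscHolomorphic.memLp_circle {f : 𝔻 → ℂ} (hf : IsDiscHolomorphic f) (p : ℝ) {r : ℝ}
    (hr : r ∈ Ioo (0 : ℝ) 1) :
    MeasureTheory.MemLp (fun θ : ℝ => discExtend f (circleMap 0 r θ)) (ENNReal.ofReal p)
      (MeasureTheory.volume.restrict (Ioc 0 (2 * π))) := by
  have hc := hf.continuous_circle hr
  obtain ⟨C, hC⟩ := isCompact_Icc.exists_bound_of_continuousOn (s := Icc 0 (2 * π)) hc.continuousOn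
  refine MeasureTheory.MemLp.of_bound hc.aestronglyMeasurable C ?_
  refine (MeasureTheory.ae_restrict_iff' measurableSet_Ioc).mpr (Filter.Eventually.of_forall ?_)
  exact fun θ hθ => hC θ (Ioc_subset_Icc_self hθ)

theorem hardyMean_eq_eLpNorm {p : ℝ} (hp : 1 ≤ p) {f : 𝔻 → ℂ} (hf : IsDiscHolomorphic f) {r : ℝ}
    (hr : r ∈ Ioo (0 : ℝ) 1) :
    hardyMean p f r = ((2 * π)⁻¹) ^ (1 / p) *
      (MeasureTheory.eLpNorm (fun θ : ℝ => discExtend f (circleMap 0 r θ)) (ENNReal.ofReal p)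
        (MeasureTheory.volume.restrict (Ioc 0 (2 * π)))).toReal := by
  have hp0 : 0 < p := by linarith
  have h0 : ENNReal.ofReal p ≠ 0 := by simpa using hp0
  rw [(hf.memLp_circle p hr).eLpNorm_eq_integral_rpow_norm h0 ENNReal.ofReal_ne_top,
    ENNReal.toReal_ofReal hp0.le, ENNReal.toReal_ofReal (by positivity), hardyMean, Real.circleAverage,
    intervalIntegral.integral_of_le (by positivity), smul_eq_mul,
    Real.mul_rpow (by positivity) (by positivity), one_div]

theorem hardyMean_add_le {p : ℝ} (hp : 1 ≤ p) {f g : 𝔻 → ℂ} (hf : IsDiscHolomorphic f)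
    (hg : IsDiscHolomorphic g) {r : ℝ} (hr : r ∈ Ioo (0 : ℝ) 1) :
    hardyMean p (f + g) r ≤ hardyMean p f r + hardyMean p g r := by
  have hfg : IsDiscHolomorphic (f + g) := by
    unfold IsDiscHolomorphic
    rw [discExtend_add]
    exact DifferentiableOn.add hf hg
  rw [hardyMean_eq_eLpNorm hp hf hr, hardyMean_eq_eLpNorm hp hg hr, hardyMean_eq_eLpNorm hp hfg hr,
    ← mul_add]
  have h1 := hf.memLp_circle p hr
  have h2 := hg.memLp_circle p hr
  gcongr
  rw [← ENNReal.toReal_add h1.2.ne h2.2.ne]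
  refine ENNReal.toReal_mono (ENNReal.add_ne_top.mpr ⟨h1.2.ne, h2.2.ne⟩) ?_
  have := MeasureTheory.eLpNorm_add_le h1.1 h2.1 (p := ENNReal.ofReal p) (by simpa using hp)
  rw [discExtend_add]
  exact this

theorem hardyMean_smul {p : ℝ} (hp : 1 ≤ p) (c : ℂ) (f : 𝔻 → ℂ) (r : ℝ) :
    hardyMean p (c • f) r = ‖c‖ * hardyMean p f r := by
  have hp0 : p ≠ 0 := by linarith
  have h : (fun z => ‖discExtend (c • f) z‖ ^ p) =
      fun z => ‖c‖ ^ p • ‖discExtend f z‖ ^ p := by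
    funext z
    rw [discExtend_smul, Pi.smul_apply, norm_smul, Real.mul_rpow (norm_nonneg _) (norm_nonneg _),
      smul_eq_mul]
  rw [hardyMean, h, Real.circleAverage_fun_smul, smul_eq_mul, Real.mul_rpow (by positivity)
    (Real.circleAverage_nonneg_of_nonneg fun x _ => by positivity), one_div,
    Real.rpow_rpow_inv (norm_nonneg _) hp0, hardyMean, one_div]

theorem hardyMean_zero {p : ℝ} (hp : 1 ≤ p) (r : ℝ) : hardyMean p 0 r = 0 := by
  simpa using hardyMean_smul hp 0 0 r

theorem eq_zero_of_hardyMean {p : ℝ} (hp : 1 ≤ p) {f : 𝔻 → ℂ} (hf : IsDiscHolomorphic f)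
    (h : ∀ r ∈ Ioo (0 : ℝ) 1, hardyMean p f r = 0) : f = 0 := by
  have hp0 : 0 < p := by linarith
  have hne : ∀ z : 𝔻, (z : ℂ) ≠ 0 → f z = 0 := by
    intro z hz
    by_contra hfz
    have hr : ‖(z : ℂ)‖ ∈ Ioo (0 : ℝ) 1 := ⟨norm_pos_iff.mpr hz, z.norm_lt_one⟩
    have hm : (z : ℂ) ∈ sphere (0 : ℂ) |‖(z : ℂ)‖| := by simp
    rw [← image_circleMap_Ioc] at hm
    obtain ⟨θ, hθ, hzθ⟩ := hm
    have hc := hf.continuous_circle hr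
    have hpos : 0 < ∫ θ in (0 : ℝ)..2 * π, ‖discExtend f (circleMap 0 ‖(z : ℂ)‖ θ)‖ ^ p := by
      refine intervalIntegral.integral_pos (by positivity) ?_ ?_ ?_
      · exact (hc.norm.rpow_const fun _ => Or.inr hp0.le).continuousOn
      · intro x _
        positivity
      · refine ⟨θ, Ioc_subset_Icc_self hθ, ?_⟩
        rw [hzθ, discExtend_coe]
        exact Real.rpow_pos_of_pos (norm_pos_iff.mpr hfz) p
    have h1 := h _ hr
    have h2 : 0 < hardyMean p f ‖(z : ℂ)‖ := by
      refine Real.rpow_pos_of_pos ?_ _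
      rw [Real.circleAverage, smul_eq_mul]
      exact mul_pos (by positivity) hpos
    linarith
  have hEq : EqOn (discExtend f) 0 (ball 0 1 \ {0}) := by
    rintro z ⟨hz, hz0⟩
    have := hne (Complex.UnitDisc.mk z (by simpa using hz)) (by simpa using hz0)
    rw [← discExtend_coe f] at this
    simpa using this
  funext z
  by_cases hz : (z : ℂ) = 0
  · have h0 : (0 : ℂ) ∈ ball (0 : ℂ) 1 := by simp
    have hcont : ContinuousAt (discExtend f) 0 :=
      (hf.continuousOn 0 h0).continuousAt (isOpen_ball.mem_nhds h0)
    have ht : Filter.Tendsto (discExtend f) (nhdsWithin 0 {0}ᶜ) (nhds (discExtend f 0)) :=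
      hcont.tendsto.mono_left nhdsWithin_le_nhds
    have ht0 : Filter.Tendsto (discExtend f) (nhdsWithin 0 {0}ᶜ) (nhds 0) := by
      refine tendsto_const_nhds.congr' ?_
      filter_upwards [self_mem_nhdsWithin, nhdsWithin_le_nhds (isOpen_ball.mem_nhds h0)]
        with w hw hw1
      exact (hEq ⟨hw1, hw⟩).symm
    have := tendsto_nhds_unique ht ht0
    rw [← discExtend_coe f, hz, this]
    rfl
  · exact hne z hz

/-- The Hardy space `H^p` as a space of functions on the disc: the holomorphic functions whose
`p`-th integral means over the circles of radius `0 < r < 1` are bounded. -/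
def hardySubmodule (p : ℝ) [Fact (1 ≤ p)] : Submodule ℂ (𝔻 → ℂ) where
  carrier := {f | IsDiscHolomorphic f ∧ BddAbove (hardyMean p f '' Ioo 0 1)}
  add_mem' := by
    rintro f g ⟨hf, C, hC⟩ ⟨hg, D, hD⟩
    refine ⟨?_, C + D, ?_⟩
    · unfold IsDiscHolomorphic
      rw [discExtend_add]
      exact DifferentiableOn.add hf hg
    · rintro _ ⟨r, hr, rfl⟩
      exact (hardyMean_add_le Fact.out hf hg hr).trans
        (add_le_add (hC (mem_image_of_mem _ hr)) (hD (mem_image_of_mem _ hr)))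
  zero_mem' := by
    refine ⟨?_, 0, ?_⟩
    · unfold IsDiscHolomorphic
      rw [discExtend_zero]
      exact differentiableOn_const 0
    · rintro _ ⟨r, hr, rfl⟩
      exact (hardyMean_zero Fact.out r).le
  smul_mem' := by
    rintro c f ⟨hf, C, hC⟩
    refine ⟨?_, ‖c‖ * C, ?_⟩
    · unfold IsDiscHolomorphic
      rw [discExtend_smul]
      exact DifferentiableOn.const_smul hf c
    · rintro _ ⟨r, hr, rfl⟩
      rw [hardyMean_smul Fact.out]
      exact mul_le_mul_of_nonneg_left (hC (mem_image_of_mem _ hr)) (norm_nonneg c)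

/-- The Hardy space `H^p` of the unit disc. -/
def HardySpace (p : ℝ) [Fact (1 ≤ p)] : Type := hardySubmodule p

namespace HardySpace

variable {p : ℝ} [Fact (1 ≤ p)]

instance : AddCommGroup (HardySpace p) := inferInstanceAs (AddCommGroup (hardySubmodule p))

instance : Module ℂ (HardySpace p) := inferInstanceAs (Module ℂ (hardySubmodule p))

/-- The inclusion of `H^p` into the space of all functions on the disc. -/
def toFun : HardySpace p →ₗ[ℂ] (𝔻 → ℂ) := (hardySubmodule p).subtype

instance : CoeFun (HardySpace p) (fun _ => 𝔻 → ℂ) := ⟨fun f => toFun f⟩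

/-- The norm of `H^p`: the supremum over `0 < r < 1` of the `p`-th integral means. -/
instance : Norm (HardySpace p) := ⟨fun f => sSup (hardyMean p f '' Ioo 0 1)⟩

theorem norm_def (f : HardySpace p) : ‖f‖ = sSup (hardyMean p f '' Ioo 0 1) := rfl

theorem hardyMean_le_norm (f : HardySpace p) {r : ℝ} (hr : r ∈ Ioo (0 : ℝ) 1) :
    hardyMean p f r ≤ ‖f‖ :=
  le_csSup f.2.2 (mem_image_of_mem _ hr)

theorem norm_le_of_forall (f : HardySpace p) {C : ℝ}
    (h : ∀ r ∈ Ioo (0 : ℝ) 1, hardyMean p f r ≤ C) : ‖f‖ ≤ C := by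
  refine csSup_le ((nonempty_Ioo.mpr one_pos).image _) ?_
  rintro _ ⟨r, hr, rfl⟩
  exact h r hr

theorem normCore : NormedSpace.Core ℂ (HardySpace p) where
  norm_nonneg f := by
    refine Real.sSup_nonneg ?_
    rintro _ ⟨r, hr, rfl⟩
    exact hardyMean_nonneg p _ r
  norm_smul c f := by
    rw [norm_def, norm_def, ← smul_eq_mul, ← Real.sSup_smul_of_nonneg (norm_nonneg c)]
    congr 1
    ext x
    simp [mem_smul_set, hardyMean_smul (p := p) Fact.out]
  norm_triangle f g := by
    refine norm_le_of_forall _ fun r hr => ?_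
    rw [map_add]
    exact (hardyMean_add_le Fact.out f.2.1 g.2.1 hr).trans
      (add_le_add (hardyMean_le_norm f hr) (hardyMean_le_norm g hr))
  norm_eq_zero_iff f := by
    constructor
    · intro h
      have : (f : 𝔻 → ℂ) = 0 := by
        refine eq_zero_of_hardyMean (p := p) Fact.out f.2.1 fun r hr => ?_
        exact le_antisymm ((hardyMean_le_norm f hr).trans h.le) (hardyMean_nonneg p _ r)
      exact Subtype.ext this
    · rintro rfl
      refine le_antisymm (norm_le_of_forall _ fun r hr => ?_) ?_
      · rw [map_zero, hardyMean_zero Fact.out]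
      · refine Real.sSup_nonneg ?_
        rintro _ ⟨r, hr, rfl⟩
        exact hardyMean_nonneg p _ r

instance : NormedAddCommGroup (HardySpace p) := NormedAddCommGroup.ofCore normCore

instance : NormedSpace ℂ (HardySpace p) := NormedSpace.ofCore normCore

end HardySpace

/-! ### Operators -/

/-- Multiplication `M_F` by a function `F` on the disc. -/
def mulOp (F : 𝔻 → ℂ) : (𝔻 → ℂ) →ₗ[ℂ] (𝔻 → ℂ) := LinearMap.mulLeft ℂ F

/-- Composition `C_φ f = f ∘ φ` with an automorphism `φ`. -/
def compOp (φ : DiscAut) : (𝔻 → ℂ) →ₗ[ℂ] (𝔻 → ℂ) := LinearMap.funLeft ℂ ℂ φ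

/-- The operator `U_φ f = (conj lam * φ')^(1/p) * (f ∘ φ)`, with the principal branch of the
power. -/
def forelliOp (p : ℝ) (φ : DiscAut) : (𝔻 → ℂ) →ₗ[ℂ] (𝔻 → ℂ) :=
  mulOp (fun z => (conj φ.lam * deriv φ.formula z) ^ ((1 / p : ℝ) : ℂ)) ∘ₗ compOp φ

/-- A bounded operator `S` on a normed space is Crownover if it is an isometry, its range has
codimension one, and the ranges of its powers `S^n`, `n ≥ 1`, have trivial intersection. -/
structure IsCrownover {X : Type*} [NormedAddCommGroup X] [NormedSpace ℂ X] (S : X →L[ℂ] X) :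
    Prop where
  isometry : Isometry S
  codim_one : Module.finrank ℂ (X ⧸ LinearMap.range (S : X →ₗ[ℂ] X)) = 1
  iInter_range : ⋂ (n : ℕ) (_ : 1 ≤ n), range (S ^ n : X →L[ℂ] X) = {0}

end

/-!
For a disc automorphism `φ`, `|φ'|` is on the unit circle the density of the pull-back of arc length
along `φ`, so `f ↦ (conj lam * φ')^(1/p) * (f ∘ φ)` preserves boundary integral means. As the circle
means of `|f|^p` increase with the radius, applying this to the dilations of `f` shows that `U_φ`,
and by the same argument for `φ⁻¹` also its inverse, does not increase the `H^p` norm; nor does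
multiplication by `ψ` change it, `|ψ|` tending to `1` at the circle. Hence `S = M_ψ U_φ` is an
isometry, and its range is the hyperplane of functions vanishing at the zero of `ψ`.

The Schwarz–Pick identity `1 - |φ z|² = |φ' z| (1 - |z|²)` yields
`(1 - |z|²) |S^n f z|^p = (∏ k < n, |ψ (φ_k z)|)^p (1 - |φ_n z|²) |f (φ_n z)|^p`, where the last two
factors have product at most `‖f‖^p = ‖S^n f‖^p`. The orbit of `z` under `φ` stays on a
pseudohyperbolic circle about the fixed point of `φ`; that is a Euclidean circle inside the disc, so
the factors `|ψ (φ_k z)|` are bounded away from `1` and the product tends to `0`. The zeros of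
`ψ ∘ φ_n` form the orbit of the zero of `ψ` under `φ⁻¹`, so they too lie on such a circle.
-/

noncomputable section

open MeasureTheory Filter Topology

/-! ### Integral means of holomorphic functions -/

section IntegralMeans

variable {E : Type*} [NormedAddCommGroup E] [NormedSpace ℂ E] [CompleteSpace E] {p r R : ℝ}
  {c w : ℂ} {h : ℂ → E}

theorem poissonKernel_nonneg {z : ℂ} (hw : w ∈ ball c R) (hz : z ∈ sphere c R) :
    0 ≤ poissonKernel c w z := by
  simp only [poissonKernel_def, sub_sub_sub_cancel_right, mem_ball_iff_norm,
    mem_sphere_iff_norm] at *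
  have : ‖w - c‖ ^ 2 ≤ ‖z - c‖ ^ 2 := by gcongr; linarith
  exact div_nonneg (sub_nonneg.mpr this) (sq_nonneg _)

theorem continuousOn_poissonKernel (hw : w ∈ ball c R) :
    ContinuousOn (poissonKernel c w) (sphere c R) := by
  rw [poissonKernel_eq_re_herglotzRieszKernel, ← abs_of_pos (pos_of_mem_ball hw)]
  exact Complex.continuous_re.comp_continuousOn (continuousOn_herglotzRieszKernel_sphere hw)

theorem circleAverage_poissonKernel (hw : w ∈ ball c R) :
    Real.circleAverage (poissonKernel c w) c R = 1 := by
  have hone := InnerProductSpace.harmonicContOnCl_const.circleAverage_poissonKernel_smul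
    (f := fun _ : ℂ => (1 : ℝ)) hw
  simpa only [smul_eq_mul, ← Pi.one_def, mul_one] using hone

theorem rpow_add_mul_sub_le_rpow {s t : ℝ} (hp : 1 ≤ p) (hs : 0 < s) (ht : 0 ≤ t) :
    s ^ p + p * s ^ (p - 1) * (t - s) ≤ t ^ p := by
  have bernoulli : 1 + p * (t / s - 1) ≤ (t / s) ^ p := by
    simpa using one_add_mul_self_le_rpow_one_add (s := t / s - 1)
      (by linarith [div_nonneg ht hs.le]) hp
  calc s ^ p + p * s ^ (p - 1) * (t - s) = s ^ p * (1 + p * (t / s - 1)) := by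
        rw [Real.rpow_sub_one hs.ne']
        field_simp
    _ ≤ s ^ p * (t / s) ^ p := by gcongr
    _ = t ^ p := by
        rw [← Real.mul_rpow hs.le (div_nonneg ht hs.le), mul_div_cancel₀ _ hs.ne']

theorem rpow_circleAverage_mul_le {P g : ℂ → ℝ} (hp : 1 ≤ p) (hR : 0 ≤ R)
    (hP : ContinuousOn P (sphere c R)) (hP0 : ∀ z ∈ sphere c R, 0 ≤ P z)
    (hP1 : Real.circleAverage P c R = 1)
    (hg : ContinuousOn g (sphere c R)) (hg0 : ∀ z ∈ sphere c R, 0 ≤ g z) :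
    Real.circleAverage (P * g) c R ^ p ≤ Real.circleAverage (fun z => P z * g z ^ p) c R := by
  have hp0 : 0 ≤ p := by linarith
  have hPg : CircleIntegrable (P * g) c R := (hP.mul hg).circleIntegrable hR
  have hPgp : CircleIntegrable (fun z => P z * g z ^ p) c R :=
    (hP.mul (hg.rpow_const fun _ _ => Or.inr hp0)).circleIntegrable hR
  rw [← abs_of_nonneg hR] at hP0 hg0
  set s := Real.circleAverage (P * g) c R with hs
  have hs0 : 0 ≤ s :=
    Real.circleAverage_nonneg_of_nonneg fun z hz => mul_nonneg (hP0 z hz) (hg0 z hz)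
  rcases hs0.eq_or_lt with hs0 | hs0
  · rw [← hs0, Real.zero_rpow (by linarith)]
    exact Real.circleAverage_nonneg_of_nonneg fun z hz =>
      mul_nonneg (hP0 z hz) (Real.rpow_nonneg (hg0 z hz) p)
  set k := p * s ^ (p - 1)
  have hP' : CircleIntegrable P c R := hP.circleIntegrable hR
  calc s ^ p = Real.circleAverage ((s ^ p - k * s) • P + k • (P * g)) c R := by
        rw [Real.circleAverage_add hP'.const_smul hPg.const_smul,
          Real.circleAverage_smul, Real.circleAverage_smul, hP1, ← hs]
        simp only [smul_eq_mul]
        ring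
    _ ≤ Real.circleAverage (fun z => P z * g z ^ p) c R := by
        refine Real.circleAverage_mono (hP'.const_smul.add hPg.const_smul) hPgp fun z hz => ?_
        have htangent := mul_le_mul_of_nonneg_left
          (rpow_add_mul_sub_le_rpow hp hs0 (hg0 z hz)) (hP0 z hz)
        simp only [Pi.add_apply, Pi.smul_apply, Pi.mul_apply, smul_eq_mul]
        linarith

theorem norm_le_circleAverage_poissonKernel_mul_norm (hh : DiffContOnCl ℂ h (ball c R))
    (hw : w ∈ ball c R) :
    ‖h w‖ ≤ Real.circleAverage (poissonKernel c w * fun z => ‖h z‖) c R := by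
  rw [← DiffContOnCl.circleAverage_poissonKernel_smul hh hw]
  calc _ ≤ Real.circleAverage (fun z => ‖(poissonKernel c w • h) z‖) c R := by
        simp only [Real.circleAverage, norm_smul, smul_eq_mul, norm_inv, norm_mul,
          RCLike.norm_ofNat, Real.norm_of_nonneg Real.pi_pos.le]
        gcongr
        exact intervalIntegral.norm_integral_le_integral_norm Real.two_pi_pos.le
    _ = _ := by
        refine Real.circleAverage_congr_sphere fun z hz => ?_
        rw [abs_of_pos (pos_of_mem_ball hw)] at hz
        simp only [Pi.smul_apply', Pi.mul_apply, norm_smul,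
          Real.norm_of_nonneg (poissonKernel_nonneg hw hz)]

theorem norm_rpow_le_circleAverage_poissonKernel_mul (hp : 1 ≤ p)
    (hh : DiffContOnCl ℂ h (ball c R)) (hw : w ∈ ball c R) :
    ‖h w‖ ^ p ≤ Real.circleAverage (fun z => poissonKernel c w z * ‖h z‖ ^ p) c R := by
  have hR := pos_of_mem_ball hw
  have hcont : ContinuousOn h (sphere c R) :=
    hh.continuousOn_ball.mono sphere_subset_closedBall
  calc ‖h w‖ ^ p ≤ Real.circleAverage (poissonKernel c w * fun z => ‖h z‖) c R ^ p := by
        gcongr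
        exact norm_le_circleAverage_poissonKernel_mul_norm hh hw
    _ ≤ _ := rpow_circleAverage_mul_le hp hR.le (continuousOn_poissonKernel hw)
        (fun z => poissonKernel_nonneg hw) (circleAverage_poissonKernel hw) hcont.norm
        fun _ _ => norm_nonneg _

theorem poissonKernel_center {z : ℂ} (hz : z ≠ c) : poissonKernel c c z = 1 := by
  simp [poissonKernel_def, sub_ne_zero.mpr hz]

theorem circleAverage_poissonKernel_center_mul {g : ℂ → ℝ} (hR : R ≠ 0) :
    Real.circleAverage (fun z => poissonKernel c c z * g z) c R = Real.circleAverage g c R := by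
  refine Real.circleAverage_congr_sphere fun z hz => ?_
  have hzc : z ≠ c := ne_of_mem_sphere hz (abs_ne_zero.mpr hR)
  simp only [poissonKernel_center hzc, one_mul]

theorem norm_center_rpow_le_circleAverage (hp : 1 ≤ p) (hR : 0 < R)
    (hh : DiffContOnCl ℂ h (ball c R)) : ‖h c‖ ^ p ≤ Real.circleAverage (‖h ·‖ ^ p) c R :=
  (norm_rpow_le_circleAverage_poissonKernel_mul hp hh (mem_ball_self hR)).trans_eq
    (circleAverage_poissonKernel_center_mul hR.ne')

theorem exists_differentiableOn_re_eq_poissonIntegral {g : ℂ → ℝ} (hg : CircleIntegrable g 0 R) :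
    ∃ H : ℂ → ℂ, DifferentiableOn ℂ H (ball 0 R) ∧ ∀ w ∈ ball 0 R,
      (H w).re = Real.circleAverage (fun z => poissonKernel 0 w z * g z) 0 R := by
  refine ⟨fun w => Real.circleAverage (fun z => herglotzRieszKernel 0 w z • (g z : ℂ)) 0 R,
    differentiableOn_circleAverage_herglotzRieszKernel_smul ?_, fun w hw => ?_⟩
  · rw [CircleIntegrable, intervalIntegrable_iff] at hg ⊢
    exact Complex.ofRealCLM.integrable_comp hg
  · rw [re_circleAverage_herglotzRieszKernel_smul hg hw, poissonKernel_eq_re_herglotzRieszKernel]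
    rfl

theorem circleAverage_re_eq_re_center {H : ℂ → ℂ} (hH : DifferentiableOn ℂ H (ball c R))
    (hr : 0 ≤ r) (hrR : r < R) : Real.circleAverage (fun z => (H z).re) c r = (H c).re := by
  have hsub : closedBall c r ⊆ ball c R := closedBall_subset_ball hrR
  have hmean : Real.circleAverage H c r = H c := by
    refine DiffContOnCl.circleAverage ?_
    rw [abs_of_nonneg hr]
    exact (hH.mono (closure_ball_subset_closedBall.trans hsub)).diffContOnCl
  rw [← hmean]
  exact Complex.reCLM.circleAverage_comp_comm
    ((hH.continuousOn.mono (sphere_subset_closedBall.trans hsub)).circleIntegrable hr)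

-- The Poisson integral of `‖h‖ ^ p` over the larger circle is a harmonic majorant of `‖h‖ ^ p`, and
-- its mean over the smaller circle is its value at the centre.
theorem circleAverage_norm_rpow_mono (hp : 1 ≤ p) (hr : 0 ≤ r) (hrR : r < R)
    (hh : DiffContOnCl ℂ h (ball 0 R)) :
    Real.circleAverage (‖h ·‖ ^ p) 0 r ≤ Real.circleAverage (‖h ·‖ ^ p) 0 R := by
  have hR : 0 < R := hr.trans_lt hrR
  have hcont : ContinuousOn (‖h ·‖ ^ p) (closedBall 0 R) :=
    hh.continuousOn_ball.norm.rpow_const fun _ _ => Or.inr (by linarith)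
  have hsub : sphere 0 r ⊆ ball (0 : ℂ) R := sphere_subset_ball hrR
  obtain ⟨H, hH, hre⟩ := exists_differentiableOn_re_eq_poissonIntegral
    ((hcont.mono sphere_subset_closedBall).circleIntegrable hR.le)
  calc Real.circleAverage (‖h ·‖ ^ p) 0 r ≤ Real.circleAverage (fun z => (H z).re) 0 r := by
        refine Real.circleAverage_mono
          ((hcont.mono (hsub.trans ball_subset_closedBall)).circleIntegrable hr)
          ((Complex.continuous_re.comp_continuousOn
            (hH.continuousOn.mono hsub)).circleIntegrable hr)
          fun w hw => ?_
        rw [abs_of_nonneg hr] at hw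
        rw [hre w (hsub hw)]
        exact norm_rpow_le_circleAverage_poissonKernel_mul hp hh (hsub hw)
    _ = (H 0).re := circleAverage_re_eq_re_center hH hr hrR
    _ = Real.circleAverage (‖h ·‖ ^ p) 0 R := by
        rw [hre 0 (mem_ball_self hR), circleAverage_poissonKernel_center_mul hR.ne']

end IntegralMeans

/-! ### Disc automorphisms -/

theorem norm_one_sub_conj_mul_sq_sub (w z : ℂ) :
    ‖1 - conj w * z‖ ^ 2 - ‖z - w‖ ^ 2 = (1 - ‖w‖ ^ 2) * (1 - ‖z‖ ^ 2) := by
  simp only [← Complex.normSq_eq_norm_sq, Complex.normSq_apply, Complex.sub_re, Complex.sub_im,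
    Complex.mul_re, Complex.mul_im, Complex.conj_re, Complex.conj_im, Complex.one_re,
    Complex.one_im]
  ring

theorem one_sub_conj_mul_re_pos {w z : ℂ} (hw : ‖w‖ < 1) (hz : ‖z‖ ≤ 1) :
    0 < (1 - conj w * z).re := by
  have hre : (conj w * z).re ≤ ‖w‖ * ‖z‖ := by
    simpa only [norm_mul, RCLike.norm_conj] using Complex.re_le_norm (conj w * z)
  have : ‖w‖ * ‖z‖ ≤ ‖w‖ := mul_le_of_le_one_right (norm_nonneg w) hz
  rw [Complex.sub_re, Complex.one_re]
  linarith

theorem one_sub_conj_mul_ne_zero {w z : ℂ} (hw : ‖w‖ < 1) (hz : ‖z‖ ≤ 1) :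
    1 - conj w * z ≠ 0 := fun h => by
  simpa [h] using one_sub_conj_mul_re_pos hw hz

theorem conj_mul_self_of_norm_eq_one {z : ℂ} (hz : ‖z‖ = 1) : conj z * z = 1 := by
  rw [Complex.conj_mul', hz, Complex.ofReal_one, one_pow]

theorem sub_eq_mul_conj_one_sub_conj_mul (w : ℂ) {z : ℂ} (hz : ‖z‖ = 1) :
    z - w = z * conj (1 - conj w * z) := by
  simp only [map_sub, map_one, map_mul, Complex.conj_conj]
  linear_combination w * conj_mul_self_of_norm_eq_one hz

theorem sq_mem_slitPlane_of_re_pos {z : ℂ} (hz : 0 < z.re) : z ^ 2 ∈ Complex.slitPlane := by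
  rw [Complex.mem_slitPlane_iff, sq, Complex.mul_re, Complex.mul_im]
  by_cases him : z.im = 0
  · left
    simp only [him, mul_zero, sub_zero]
    positivity
  · right
    rw [mul_comm z.im, ← two_mul]
    exact mul_ne_zero two_ne_zero (mul_ne_zero hz.ne' him)

namespace DiscAut

variable (φ : DiscAut) {z w : ℂ}

theorem coe_apply (z : 𝔻) : (φ z : ℂ) = φ.formula z := rfl

theorem one_sub_norm_a_sq_pos : 0 < 1 - ‖φ.a‖ ^ 2 := by
  simpa only [sub_pos] using pow_lt_one₀ (norm_nonneg φ.a) φ.norm_a two_ne_zero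

theorem hasDerivAt_formula (hz : ‖z‖ ≤ 1) :
    HasDerivAt φ.formula (φ.lam * (1 - ‖φ.a‖ ^ 2 : ℝ) / (1 - conj φ.a * z) ^ 2) z := by
  have hnum : HasDerivAt (fun z => φ.lam * (z - φ.a)) (φ.lam * 1) z :=
    ((hasDerivAt_id' z).sub_const φ.a).const_mul φ.lam
  have hden : HasDerivAt (fun z => 1 - conj φ.a * z) (-(conj φ.a * 1)) z :=
    ((hasDerivAt_id' z).const_mul (conj φ.a)).const_sub 1
  refine (hnum.div hden (one_sub_conj_mul_ne_zero φ.norm_a hz)).congr_deriv ?_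
  push_cast
  rw [← Complex.conj_mul']
  ring

theorem deriv_formula (hz : ‖z‖ ≤ 1) :
    deriv φ.formula z = φ.lam * (1 - ‖φ.a‖ ^ 2 : ℝ) / (1 - conj φ.a * z) ^ 2 :=
  (φ.hasDerivAt_formula hz).deriv

theorem differentiableAt_formula (hz : ‖z‖ ≤ 1) : DifferentiableAt ℂ φ.formula z :=
  (φ.hasDerivAt_formula hz).differentiableAt

theorem differentiableOn_formula : DifferentiableOn ℂ φ.formula (closedBall 0 1) := fun _ hz =>
  (φ.differentiableAt_formula (mem_closedBall_zero_iff.mp hz)).differentiableWithinAt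

theorem mapsTo_formula : MapsTo φ.formula (ball 0 1) (ball 0 1) := fun _ hz =>
  mem_ball_zero_iff.mpr (φ.norm_formula_lt_one (mem_ball_zero_iff.mp hz))

theorem differentiableAt_deriv_formula (hz : ‖z‖ ≤ 1) :
    DifferentiableAt ℂ (deriv φ.formula) z := by
  have hne : ∀ᶠ w in 𝓝 z, 1 - conj φ.a * w ≠ 0 :=
    ContinuousAt.eventually_ne (by fun_prop) (one_sub_conj_mul_ne_zero φ.norm_a hz)
  have hdiff : ∀ᶠ w in 𝓝 z, DifferentiableAt ℂ φ.formula w := by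
    filter_upwards [hne] with w hw
    unfold formula
    fun_prop (disch := exact hw)
  exact (Complex.analyticAt_iff_eventually_differentiableAt.mpr hdiff).deriv.differentiableAt

theorem norm_deriv_formula (hz : ‖z‖ ≤ 1) :
    ‖deriv φ.formula z‖ = (1 - ‖φ.a‖ ^ 2) / ‖1 - conj φ.a * z‖ ^ 2 := by
  rw [φ.deriv_formula hz, norm_div, norm_mul, φ.norm_lam, one_mul, Complex.norm_real,
    Real.norm_of_nonneg φ.one_sub_norm_a_sq_pos.le, norm_pow]

theorem norm_deriv_formula_pos (hz : ‖z‖ ≤ 1) : 0 < ‖deriv φ.formula z‖ := by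
  rw [φ.norm_deriv_formula hz]
  have hne := one_sub_conj_mul_ne_zero φ.norm_a hz
  exact div_pos φ.one_sub_norm_a_sq_pos (by positivity)

theorem one_sub_norm_formula_sq (hz : ‖z‖ ≤ 1) :
    1 - ‖φ.formula z‖ ^ 2 = ‖deriv φ.formula z‖ * (1 - ‖z‖ ^ 2) := by
  have hne := one_sub_conj_mul_ne_zero φ.norm_a hz
  rw [φ.norm_deriv_formula hz, div_mul_eq_mul_div, ← norm_one_sub_conj_mul_sq_sub, formula,
    norm_div, norm_mul, φ.norm_lam, one_mul, div_pow, eq_div_iff (by positivity), sub_mul, one_mul,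
    div_mul_cancel₀ _ (by positivity)]

theorem norm_formula_le_one (hz : ‖z‖ ≤ 1) : ‖φ.formula z‖ ≤ 1 := by
  have hz2 : 0 ≤ 1 - ‖z‖ ^ 2 := sub_nonneg.mpr (pow_le_one₀ (norm_nonneg z) hz)
  have h := mul_nonneg (norm_nonneg (deriv φ.formula z)) hz2
  rw [← φ.one_sub_norm_formula_sq hz] at h
  exact (sq_le_one_iff₀ (norm_nonneg _)).mp (sub_nonneg.mp h)

theorem norm_formula_eq_one (hz : ‖z‖ = 1) : ‖φ.formula z‖ = 1 := by
  have h := φ.one_sub_norm_formula_sq hz.le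
  rw [hz, one_pow, sub_self, mul_zero, sub_eq_zero] at h
  exact (pow_eq_one_iff_of_nonneg (norm_nonneg _) two_ne_zero).mp h.symm

/-- The inverse automorphism. -/
def inv : DiscAut where
  lam := conj φ.lam
  a := -φ.lam * φ.a
  norm_lam := by rw [RCLike.norm_conj, φ.norm_lam]
  norm_a := by rw [norm_mul, norm_neg, φ.norm_lam, one_mul]; exact φ.norm_a

theorem inv_formula_formula (hz : ‖z‖ ≤ 1) : φ.inv.formula (φ.formula z) = z := by
  have hden := one_sub_conj_mul_ne_zero φ.inv.norm_a (φ.norm_formula_le_one hz)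
  have hne : 1 - z * conj φ.a ≠ 0 := mul_comm z _ ▸ one_sub_conj_mul_ne_zero φ.norm_a hz
  rw [formula, div_eq_iff hden]
  simp only [inv, formula, map_mul, map_neg]
  field_simp
  linear_combination (z - z ^ 2 * conj φ.a) * conj_mul_self_of_norm_eq_one φ.norm_lam

theorem inv_inv : φ.inv.inv = φ := by
  have hlam := conj_mul_self_of_norm_eq_one φ.norm_lam
  rcases φ with ⟨lam, a, _, _⟩
  simp only [inv, Complex.conj_conj, mk.injEq, true_and]
  linear_combination a * hlam

theorem formula_inv_formula (hz : ‖z‖ ≤ 1) : φ.formula (φ.inv.formula z) = z := by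
  simpa only [inv_inv] using φ.inv.inv_formula_formula hz

theorem leftInverse_inv : LeftInverse φ.inv φ := fun z =>
  Complex.UnitDisc.coe_injective (φ.inv_formula_formula z.norm_lt_one.le)

theorem rightInverse_inv : Function.RightInverse φ.inv φ := fun z =>
  Complex.UnitDisc.coe_injective (φ.formula_inv_formula z.norm_lt_one.le)

theorem norm_deriv_inv_formula_mul (hz : ‖z‖ < 1) :
    ‖deriv φ.inv.formula z‖ * ‖deriv φ.formula (φ.inv.formula z)‖ = 1 := by
  have hcomp : φ.formula ∘ φ.inv.formula =ᶠ[𝓝 z] id := by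
    filter_upwards [isOpen_ball.mem_nhds (mem_ball_zero_iff.mpr hz)] with w hw
    exact φ.formula_inv_formula (mem_ball_zero_iff.mp hw).le
  rw [mul_comm, ← norm_mul, ← deriv_comp z
    (φ.differentiableAt_formula (φ.inv.norm_formula_le_one hz.le))
    (φ.inv.differentiableAt_formula hz.le), hcomp.deriv_eq, deriv_id, norm_one]

/-- The zero of the automorphism, as a point of the disc. -/
def zero : 𝔻 := Complex.UnitDisc.mk φ.a φ.norm_a

theorem apply_eq_zero_iff {z : 𝔻} : φ z = 0 ↔ z = φ.zero := by
  have hden := one_sub_conj_mul_ne_zero φ.norm_a z.norm_lt_one.le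
  have hlam : φ.lam ≠ 0 := norm_ne_zero_iff.mp (by simp [φ.norm_lam])
  rw [← Complex.UnitDisc.coe_eq_zero, coe_apply, formula, ← Complex.UnitDisc.coe_inj]
  simp [hden, hlam, sub_eq_zero, zero]

/-! ### The weight of a disc automorphism -/

/-- The weight `(conj lam * φ')^(1/p)` of the composition operator `U_φ`, as a function of a complex
variable. -/
def weight (p : ℝ) (z : ℂ) : ℂ := (conj φ.lam * deriv φ.formula z) ^ ((1 / p : ℝ) : ℂ)

theorem conj_lam_mul_deriv_formula_mem_slitPlane (hz : ‖z‖ ≤ 1) :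
    conj φ.lam * deriv φ.formula z ∈ Complex.slitPlane := by
  have hsq : conj φ.lam * deriv φ.formula z =
      ((√(1 - ‖φ.a‖ ^ 2) : ℝ) * (1 - conj φ.a * z)⁻¹) ^ 2 := by
    rw [φ.deriv_formula hz, mul_pow, inv_pow, ← Complex.ofReal_pow,
      Real.sq_sqrt φ.one_sub_norm_a_sq_pos.le, ← div_eq_mul_inv, ← mul_div_assoc, ← mul_assoc,
      conj_mul_self_of_norm_eq_one φ.norm_lam, one_mul]
  rw [hsq]
  refine sq_mem_slitPlane_of_re_pos ?_
  rw [Complex.re_ofReal_mul, Complex.inv_re]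
  exact mul_pos (Real.sqrt_pos.mpr φ.one_sub_norm_a_sq_pos)
    (div_pos (one_sub_conj_mul_re_pos φ.norm_a hz)
      (Complex.normSq_pos.mpr (one_sub_conj_mul_ne_zero φ.norm_a hz)))

theorem differentiableOn_weight (p : ℝ) : DifferentiableOn ℂ (φ.weight p) (closedBall 0 1) :=
  fun _ hz =>
    have hz := mem_closedBall_zero_iff.mp hz
    (((φ.differentiableAt_deriv_formula hz).const_mul _).cpow_const
      (φ.conj_lam_mul_deriv_formula_mem_slitPlane hz)).differentiableWithinAt

theorem differentiableOn_weight_mul_comp (p : ℝ) {F : ℂ → ℂ}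
    (hF : DifferentiableOn ℂ F (ball 0 1)) :
    DifferentiableOn ℂ (fun z => φ.weight p z * F (φ.formula z)) (ball 0 1) :=
  ((φ.differentiableOn_weight p).mono ball_subset_closedBall).mul
    (hF.comp (φ.differentiableOn_formula.mono ball_subset_closedBall) φ.mapsTo_formula)

theorem norm_weight (p : ℝ) (z : ℂ) : ‖φ.weight p z‖ = ‖deriv φ.formula z‖ ^ (1 / p) := by
  rw [weight, Complex.norm_cpow_real, norm_mul, RCLike.norm_conj, φ.norm_lam, one_mul]

theorem norm_weight_rpow {p : ℝ} (hp : p ≠ 0) (z : ℂ) :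
    ‖φ.weight p z‖ ^ p = ‖deriv φ.formula z‖ := by
  rw [norm_weight, one_div, Real.rpow_inv_rpow (norm_nonneg _) hp]

theorem weight_ne_zero (p : ℝ) (hz : ‖z‖ ≤ 1) : φ.weight p z ≠ 0 := by
  rw [← norm_pos_iff, norm_weight]
  exact Real.rpow_pos_of_pos (φ.norm_deriv_formula_pos hz) _

theorem norm_weight_inv_mul (p : ℝ) (hz : ‖z‖ < 1) :
    ‖φ.inv.weight p z‖ * ‖φ.weight p (φ.inv.formula z)‖ = 1 := by
  rw [norm_weight, norm_weight, ← Real.mul_rpow (norm_nonneg _) (norm_nonneg _),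
    φ.norm_deriv_inv_formula_mul hz, Real.one_rpow]

end DiscAut

/-! ### The pseudohyperbolic distance -/

/-- The pseudohyperbolic distance `|z - w| / |1 - conj w * z|` of two points of the unit disc. -/
def pseudohyperbolicDist (z w : ℂ) : ℝ := ‖z - w‖ / ‖1 - conj w * z‖

namespace DiscAut

variable (φ : DiscAut) {z w : ℂ}

theorem norm_formula_sub_formula_sq (hz : ‖z‖ ≤ 1) (hw : ‖w‖ ≤ 1) :
    ‖φ.formula z - φ.formula w‖ ^ 2 =
      ‖deriv φ.formula z‖ * ‖deriv φ.formula w‖ * ‖z - w‖ ^ 2 := by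
  have hz1 := one_sub_conj_mul_ne_zero φ.norm_a hz
  have hw1 := one_sub_conj_mul_ne_zero φ.norm_a hw
  have hsub : φ.formula z - φ.formula w =
      φ.lam * ((1 - ‖φ.a‖ ^ 2 : ℝ) * (z - w)) / ((1 - conj φ.a * z) * (1 - conj φ.a * w)) := by
    rw [formula, formula, div_sub_div _ _ hz1 hw1]
    push_cast
    rw [← Complex.conj_mul']
    ring
  rw [φ.norm_deriv_formula hz, φ.norm_deriv_formula hw, hsub, norm_div, norm_mul, norm_mul,
    norm_mul, φ.norm_lam, Complex.norm_real, Real.norm_of_nonneg φ.one_sub_norm_a_sq_pos.le]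
  ring

theorem norm_one_sub_conj_formula_mul_formula_sq (hz : ‖z‖ ≤ 1) (hw : ‖w‖ ≤ 1) :
    ‖1 - conj (φ.formula w) * φ.formula z‖ ^ 2 =
      ‖deriv φ.formula z‖ * ‖deriv φ.formula w‖ * ‖1 - conj w * z‖ ^ 2 := by
  linear_combination norm_one_sub_conj_mul_sq_sub (φ.formula w) (φ.formula z) +
    φ.norm_formula_sub_formula_sq hz hw + (1 - ‖φ.formula w‖ ^ 2) * φ.one_sub_norm_formula_sq hz +
    ‖deriv φ.formula z‖ * (1 - ‖z‖ ^ 2) * φ.one_sub_norm_formula_sq hw -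
    ‖deriv φ.formula z‖ * ‖deriv φ.formula w‖ * norm_one_sub_conj_mul_sq_sub w z

theorem pseudohyperbolicDist_formula (hz : ‖z‖ ≤ 1) (hw : ‖w‖ ≤ 1) :
    pseudohyperbolicDist (φ.formula z) (φ.formula w) = pseudohyperbolicDist z w := by
  refine (sq_eq_sq₀ (by unfold pseudohyperbolicDist; positivity)
    (by unfold pseudohyperbolicDist; positivity)).mp ?_
  rw [pseudohyperbolicDist, pseudohyperbolicDist, div_pow, div_pow,
    φ.norm_formula_sub_formula_sq hz hw, φ.norm_one_sub_conj_formula_mul_formula_sq hz hw]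
  exact mul_div_mul_left _ _
    (mul_pos (φ.norm_deriv_formula_pos hz) (φ.norm_deriv_formula_pos hw)).ne'

end DiscAut

/-! ### Change of variables on the unit circle -/

section ChangeOfVariables

variable {γ : ℝ → ℂ} {ρ : ℝ → ℝ}

theorem exists_eq_circleMap_integral_add (hρ : Continuous ρ)
    (hγ : ∀ θ, HasDerivAt γ (γ θ * (ρ θ * Complex.I)) θ) (hγ0 : ‖γ 0‖ = 1) :
    ∃ α : ℝ, ∀ θ, γ θ = circleMap 0 1 ((∫ t in (0 : ℝ)..θ, ρ t) + α) := by
  have hderiv : ∀ θ, HasDerivAt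
      (fun θ => γ θ * Complex.exp (-((∫ t in (0 : ℝ)..θ, ρ t : ℝ) * Complex.I))) 0 θ := fun θ => by
    have hprim := (hρ.integral_hasStrictDerivAt 0 θ).hasDerivAt.ofReal_comp
    refine ((hγ θ).mul (hprim.mul_const Complex.I).neg.cexp).congr_deriv ?_
    ring
  have hconst : ∀ θ, γ θ * Complex.exp (-((∫ t in (0 : ℝ)..θ, ρ t : ℝ) * Complex.I)) = γ 0 :=
    fun θ => by
      simpa using is_const_of_deriv_eq_zero (fun θ => (hderiv θ).differentiableAt)
        (fun θ => (hderiv θ).deriv) θ 0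
  refine ⟨(γ 0).arg, fun θ => ?_⟩
  have hpolar : Complex.exp ((γ 0).arg * Complex.I) = γ 0 := by
    simpa [hγ0] using Complex.norm_mul_exp_arg_mul_I (γ 0)
  rw [circleMap, zero_add, Complex.ofReal_one, one_mul, Complex.ofReal_add, add_mul,
    Complex.exp_add, hpolar, ← hconst θ, mul_comm, mul_assoc, ← Complex.exp_add, neg_add_cancel,
    Complex.exp_zero, mul_one]

theorem integral_smul_comp_eq_integral_circleMap {E : Type*} [NormedAddCommGroup E]
    [NormedSpace ℝ E] {u : ℂ → E} (hρ : Continuous ρ)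
    (hγ : ∀ θ, HasDerivAt γ (γ θ * (ρ θ * Complex.I)) θ) (hγ0 : ‖γ 0‖ = 1)
    (hperiod : ∫ t in (0 : ℝ)..2 * π, ρ t = 2 * π) (hu : ContinuousOn u (sphere 0 1)) :
    ∫ θ in (0 : ℝ)..2 * π, ρ θ • u (γ θ) = ∫ θ in (0 : ℝ)..2 * π, u (circleMap 0 1 θ) := by
  obtain ⟨α, hα⟩ := exists_eq_circleMap_integral_add hρ hγ hγ0
  have hcont : Continuous fun s : ℝ => u (circleMap 0 1 s) :=
    hu.comp_continuous (continuous_circleMap 0 1) (circleMap_mem_sphere 0 zero_le_one)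
  have hper : Function.Periodic (fun s : ℝ => u (circleMap 0 1 s)) (2 * π) := fun s => by
    simp only [periodic_circleMap 0 1 s]
  calc ∫ θ in (0 : ℝ)..2 * π, ρ θ • u (γ θ)
      = ∫ s in α..α + 2 * π, u (circleMap 0 1 s) := by
        simpa [hα, hperiod, add_comm] using intervalIntegral.integral_deriv_smul_comp
          (a := 0) (b := 2 * π)
          (fun θ _ => ((hρ.integral_hasStrictDerivAt 0 θ).hasDerivAt.add_const α))
          hρ.continuousOn hcont
    _ = ∫ θ in (0 : ℝ)..2 * π, u (circleMap 0 1 θ) := by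
        simpa using hper.intervalIntegral_add_eq α 0

end ChangeOfVariables

namespace DiscAut

variable (φ : DiscAut) {z : ℂ}

theorem norm_deriv_formula_eq_poissonKernel (hz : ‖z‖ = 1) :
    ‖deriv φ.formula z‖ = poissonKernel 0 φ.a z := by
  rw [φ.norm_deriv_formula hz.le, poissonKernel_def, sub_zero, sub_zero,
    sub_eq_mul_conj_one_sub_conj_mul φ.a hz, norm_mul, hz, one_mul, RCLike.norm_conj, one_pow]

theorem deriv_formula_mul_self (hz : ‖z‖ = 1) :
    deriv φ.formula z * z = φ.formula z * ‖deriv φ.formula z‖ := by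
  have hne := one_sub_conj_mul_ne_zero φ.norm_a hz.le
  have hne' := (map_ne_zero (starRingEnd ℂ)).mpr hne
  rw [φ.norm_deriv_formula hz.le, φ.deriv_formula hz.le, formula,
    sub_eq_mul_conj_one_sub_conj_mul φ.a hz]
  push_cast
  rw [← Complex.mul_conj' (1 - _)]
  field_simp

theorem circleAverage_norm_deriv_smul_comp_formula {E : Type*} [NormedAddCommGroup E]
    [NormedSpace ℝ E] {u : ℂ → E} (hu : ContinuousOn u (sphere 0 1)) :
    Real.circleAverage (fun z => ‖deriv φ.formula z‖ • u (φ.formula z)) 0 1 =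
      Real.circleAverage u 0 1 := by
  have hnorm : ∀ θ : ℝ, ‖circleMap 0 1 θ‖ = 1 := by simp
  have hperiod : ∫ θ in (0 : ℝ)..2 * π, ‖deriv φ.formula (circleMap 0 1 θ)‖ = 2 * π := by
    have hone := circleAverage_poissonKernel (R := 1) (mem_ball_zero_iff.mpr φ.norm_a)
    simp_rw [fun θ => φ.norm_deriv_formula_eq_poissonKernel (hnorm θ)]
    rwa [Real.circleAverage, smul_eq_mul, inv_mul_eq_one₀ Real.two_pi_pos.ne', eq_comm] at hone
  have hcont : Continuous fun θ : ℝ => ‖deriv φ.formula (circleMap 0 1 θ)‖ :=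
    continuous_iff_continuousAt.mpr fun θ =>
      ((φ.differentiableAt_deriv_formula (hnorm θ).le).continuousAt.comp
        (continuous_circleMap 0 1).continuousAt).norm
  rw [Real.circleAverage, Real.circleAverage,
    ← integral_smul_comp_eq_integral_circleMap (γ := fun θ => φ.formula (circleMap 0 1 θ))
      (ρ := fun θ => ‖deriv φ.formula (circleMap 0 1 θ)‖) hcont (fun θ => ?_)
      (φ.norm_formula_eq_one (hnorm 0)) hperiod hu]
  have hchain := (φ.differentiableAt_formula (hnorm θ).le).hasDerivAt.comp θ
    (hasDerivAt_circleMap 0 1 θ)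
  refine hchain.congr_deriv ?_
  rw [← mul_assoc, φ.deriv_formula_mul_self (hnorm θ), mul_assoc]

end DiscAut

/-! ### Bounded integral means on the unit disc -/

/-- The integral means over the circles `|z| = r < 1` of the `p`-th power of `|F|` are at most `C`;
the `H^p` norm is bounded by `C` when this holds with bound `C ^ p`. -/
def CircleMeansLE (p : ℝ) (F : ℂ → ℂ) (C : ℝ) : Prop :=
  ∀ r ∈ Ioo (0 : ℝ) 1, Real.circleAverage (fun z => ‖F z‖ ^ p) 0 r ≤ C

theorem mem_ball_of_mem_sphere_abs {r : ℝ} (hr : r ∈ Ioo (0 : ℝ) 1) {z : ℂ}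
    (hz : z ∈ sphere 0 |r|) : z ∈ ball (0 : ℂ) 1 := by
  rw [abs_of_pos hr.1] at hz
  exact sphere_subset_ball hr.2 hz

theorem continuousOn_circleAverage_parametric {X E : Type*} [TopologicalSpace X]
    [NormedAddCommGroup E] [NormedSpace ℝ E] {s : Set X} {f : X → ℂ → E} {c : ℂ} {r : ℝ}
    (hf : ContinuousOn (uncurry f) (s ×ˢ sphere c |r|)) :
    ContinuousOn (fun x => Real.circleAverage (f x) c r) s := by
  rw [continuousOn_iff_continuous_domRestrict]
  refine (intervalIntegral.continuous_parametric_intervalIntegral_of_continuous'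
    (f := fun (x : s) θ => f x (circleMap c r θ)) ?_ 0 (2 * π)).const_smul (2 * π)⁻¹
  exact hf.comp_continuous (f := fun q : s × ℝ => ((q.1 : X), circleMap c r q.2)) (by fun_prop)
    fun q => ⟨q.1.2, circleMap_mem_sphere' c r q.2⟩

namespace CircleMeansLE

variable {p C : ℝ} {F G : ℂ → ℂ}

theorem congr (h : ∀ z ∈ ball (0 : ℂ) 1, ‖F z‖ = ‖G z‖) :
    CircleMeansLE p F C ↔ CircleMeansLE p G C :=
  forall₂_congr fun r hr => by
    rw [Real.circleAverage_congr_sphere fun z hz =>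
      congrArg (· ^ p) (h z (mem_ball_of_mem_sphere_abs hr hz))]

end CircleMeansLE

namespace DiscAut

variable (φ : DiscAut) {p C : ℝ} {F : ℂ → ℂ}

theorem circleAverage_weight_mul_comp_le {r : ℝ} (hp : 1 ≤ p) (hr : r ∈ Ico (0 : ℝ) 1)
    (hF : DiffContOnCl ℂ F (ball 0 1)) :
    Real.circleAverage (fun z => ‖φ.weight p z * F (φ.formula z)‖ ^ p) 0 r ≤
      Real.circleAverage (fun z => ‖F z‖ ^ p) 0 1 := by
  have hweight : DiffContOnCl ℂ (φ.weight p) (ball 0 1) :=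
    (φ.differentiableOn_weight p).diffContOnCl_ball le_rfl
  have hcomp : DiffContOnCl ℂ (F ∘ φ.formula) (ball 0 1) :=
    hF.comp (φ.differentiableOn_formula.diffContOnCl_ball le_rfl) φ.mapsTo_formula
  have hsphere : ContinuousOn (fun z => ‖F z‖ ^ p) (sphere 0 1) :=
    ((hF.continuousOn_ball.mono sphere_subset_closedBall).norm).rpow_const
      fun _ _ => Or.inr (by linarith)
  calc Real.circleAverage (fun z => ‖φ.weight p z * F (φ.formula z)‖ ^ p) 0 r
      ≤ Real.circleAverage (fun z => ‖φ.weight p z * F (φ.formula z)‖ ^ p) 0 1 :=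
        circleAverage_norm_rpow_mono hp hr.1 hr.2 (hweight.smul hcomp)
    _ = Real.circleAverage (fun z => ‖deriv φ.formula z‖ • ‖F (φ.formula z)‖ ^ p) 0 1 := by
        simp only [norm_mul, Real.mul_rpow (norm_nonneg _) (norm_nonneg _),
          φ.norm_weight_rpow (by linarith : p ≠ 0), smul_eq_mul]
    _ = Real.circleAverage (fun z => ‖F z‖ ^ p) 0 1 :=
        φ.circleAverage_norm_deriv_smul_comp_formula hsphere

theorem circleAverage_weight_mul_dilation_comp_le {r R : ℝ} (hp : 1 ≤ p) (hr : r ∈ Ico (0 : ℝ) 1)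
    (hR : R ∈ Ioo (0 : ℝ) 1) (hF : DifferentiableOn ℂ F (ball 0 1)) :
    Real.circleAverage (fun z => ‖φ.weight p z * F (R * φ.formula z)‖ ^ p) 0 r ≤
      Real.circleAverage (fun z => ‖F z‖ ^ p) 0 R := by
  have hmaps : MapsTo (fun z => R * z : ℂ → ℂ) (closedBall 0 1) (ball 0 1) := fun z hz => by
    rw [mem_closedBall_zero_iff] at hz
    rw [mem_ball_zero_iff, norm_mul, Complex.norm_real, Real.norm_of_nonneg hR.1.le]
    exact (mul_le_of_le_one_right hR.1.le hz).trans_lt hR.2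
  have hdil : DiffContOnCl ℂ (fun z => F (R * z)) (ball 0 1) :=
    (hF.comp (by fun_prop) hmaps).diffContOnCl_ball le_rfl
  refine (φ.circleAverage_weight_mul_comp_le hp hr hdil).trans_eq ?_
  simp [Real.circleAverage, circleMap]

theorem continuousOn_circleAverage_weight_mul_dilation_comp {r : ℝ} (hr : r ∈ Ioo (0 : ℝ) 1)
    (hp : 0 ≤ p) (hF : ContinuousOn F (ball 0 1)) :
    ContinuousOn (fun R : ℝ =>
      Real.circleAverage (fun z => ‖φ.weight p z * F (R * φ.formula z)‖ ^ p) 0 r) (Ioc 0 1) := by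
  have hsphere : MapsTo Prod.snd (Ioc (0 : ℝ) 1 ×ˢ sphere (0 : ℂ) |r|) (closedBall 0 1) :=
    fun _ hq => ball_subset_closedBall (mem_ball_of_mem_sphere_abs hr hq.2)
  have hdil : MapsTo (fun q : ℝ × ℂ => q.1 * φ.formula q.2) (Ioc 0 1 ×ˢ sphere 0 |r|)
      (ball 0 1) := by
    rintro ⟨R, z⟩ ⟨hR, hz⟩
    rw [mem_ball_zero_iff, norm_mul, Complex.norm_real, Real.norm_of_nonneg hR.1.le]
    exact (mul_le_of_le_one_left (norm_nonneg _) hR.2).trans_lt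
      (mem_ball_zero_iff.mp (φ.mapsTo_formula (mem_ball_of_mem_sphere_abs hr hz)))
  refine continuousOn_circleAverage_parametric (ContinuousOn.rpow_const (ContinuousOn.norm ?_)
    fun _ _ => Or.inr hp)
  exact ((φ.differentiableOn_weight p).continuousOn.comp continuousOn_snd hsphere).mul
    (hF.comp ((Complex.continuous_ofReal.comp continuous_fst).continuousOn.mul
      (φ.differentiableOn_formula.continuousOn.comp continuousOn_snd hsphere)) hdil)

end DiscAut

theorem eventually_forall_sphere_le_norm {G : ℂ → ℂ} {m : ℝ} (hG : ContinuousOn G (closedBall 0 1))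
    (hm : ∀ z ∈ sphere (0 : ℂ) 1, m < ‖G z‖) :
    ∀ᶠ s in 𝓝[<] (1 : ℝ), ∀ z ∈ sphere (0 : ℂ) s, m ≤ ‖G z‖ := by
  obtain ⟨t, ht1, ht⟩ := exists_lt_subset_ball
    (hG.norm.preimage_isClosed_of_isClosed isClosed_closedBall isClosed_Iic)
    fun z ⟨hz, hzm⟩ => (mem_closedBall.mp hz).lt_of_ne fun h => (hm z h).not_ge hzm
  filter_upwards [Ioo_mem_nhdsLT ht1] with s hs z hz
  by_contra! hlt
  exact hs.1.not_gt (mem_sphere.mp hz ▸ mem_ball.mp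
    (ht ⟨closedBall_subset_closedBall hs.2.le (sphere_subset_closedBall hz), hlt.le⟩))

theorem rpow_mul_circleAverage_le_circleAverage_mul {F G : ℂ → ℂ} {p m s : ℝ} (hp : 0 ≤ p)
    (hm : 0 ≤ m) (hs : 0 ≤ s) (hG : ContinuousOn G (sphere 0 s)) (hF : ContinuousOn F (sphere 0 s))
    (hGm : ∀ z ∈ sphere (0 : ℂ) s, m ≤ ‖G z‖) :
    m ^ p * Real.circleAverage (fun z => ‖F z‖ ^ p) 0 s ≤
      Real.circleAverage (fun z => ‖G z * F z‖ ^ p) 0 s := by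
  rw [← smul_eq_mul, ← Real.circleAverage_fun_smul]
  refine Real.circleAverage_mono (ContinuousOn.circleIntegrable hs
    ((hF.norm.rpow_const fun _ _ => Or.inr hp).const_smul (m ^ p)))
    (ContinuousOn.circleIntegrable hs ((hG.mul hF).norm.rpow_const fun _ _ => Or.inr hp))
    fun z hz => ?_
  rw [abs_of_nonneg hs] at hz
  rw [norm_mul, Real.mul_rpow (norm_nonneg _) (norm_nonneg _), smul_eq_mul]
  have := hGm z hz
  gcongr

namespace CircleMeansLE

variable {p C : ℝ} {F G : ℂ → ℂ}

theorem weight_mul_comp (hp : 1 ≤ p) (φ : DiscAut) (hF : DifferentiableOn ℂ F (ball 0 1))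
    (hC : CircleMeansLE p F C) :
    CircleMeansLE p (fun z => φ.weight p z * F (φ.formula z)) C := fun r hr => by
  have hcont :=
    φ.continuousOn_circleAverage_weight_mul_dilation_comp hr (by linarith) hF.continuousOn
  have hclosure : (1 : ℝ) ∈ closure (Ioo 0 1) := by simp [closure_Ioo]
  simpa using ((hcont 1 (by simp)).mono Ioo_subset_Ioc_self).closure_le hclosure
    continuousWithinAt_const fun R hR =>
      (φ.circleAverage_weight_mul_dilation_comp_le hp (Ioo_subset_Ico_self hr) hR hF).trans
        (hC R hR)

theorem weight_mul_comp_iff (hp : 1 ≤ p) (φ : DiscAut) (hF : DifferentiableOn ℂ F (ball 0 1)) :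
    CircleMeansLE p (fun z => φ.weight p z * F (φ.formula z)) C ↔ CircleMeansLE p F C := by
  refine ⟨fun h => ?_, fun h => h.weight_mul_comp hp φ hF⟩
  refine (congr fun z hz => ?_).mp (h.weight_mul_comp hp φ.inv
    (φ.differentiableOn_weight_mul_comp p hF))
  have hz := mem_ball_zero_iff.mp hz
  rw [φ.formula_inv_formula hz.le, ← mul_assoc, norm_mul, norm_mul, φ.norm_weight_inv_mul p hz,
    one_mul]

theorem of_mul (hp : 1 ≤ p) (hG : ContinuousOn G (closedBall 0 1))
    (hG1 : ∀ z ∈ sphere (0 : ℂ) 1, 1 ≤ ‖G z‖) (hF : DifferentiableOn ℂ F (ball 0 1))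
    (hC : CircleMeansLE p (fun z => G z * F z) C) : CircleMeansLE p F C := fun r hr => by
  have hscaled : ∀ m ∈ Ioo (0 : ℝ) 1,
      m ^ p * Real.circleAverage (fun z => ‖F z‖ ^ p) 0 r ≤ C := fun m hm => by
    obtain ⟨s, hGs, hrs, hs1⟩ := ((eventually_forall_sphere_le_norm hG fun z hz =>
      hm.2.trans_le (hG1 z hz)).and (Ioo_mem_nhdsLT hr.2)).exists
    have hs0 : 0 < s := hr.1.trans hrs
    have hGc := hG.mono (sphere_subset_closedBall.trans (closedBall_subset_closedBall hs1.le))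
    calc m ^ p * Real.circleAverage (fun z => ‖F z‖ ^ p) 0 r
        ≤ m ^ p * Real.circleAverage (fun z => ‖F z‖ ^ p) 0 s :=
          mul_le_mul_of_nonneg_left (circleAverage_norm_rpow_mono hp hr.1.le hrs
            (hF.diffContOnCl_ball (closedBall_subset_ball hs1))) (Real.rpow_nonneg hm.1.le p)
      _ ≤ Real.circleAverage (fun z => ‖G z * F z‖ ^ p) 0 s :=
          rpow_mul_circleAverage_le_circleAverage_mul (by linarith) hm.1.le hs0.le hGc
            (hF.continuousOn.mono (sphere_subset_ball hs1)) hGs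
      _ ≤ C := hC s ⟨hs0, hs1⟩
  have hcont : ContinuousAt
      (fun m : ℝ => m ^ p * Real.circleAverage (fun z => ‖F z‖ ^ p) 0 r) 1 :=
    (Real.continuousAt_rpow_const 1 p (Or.inl one_ne_zero)).mul continuousAt_const
  have hlim := hcont.tendsto.mono_left (nhdsWithin_le_nhds (s := Iio 1))
  rw [Real.one_rpow, one_mul] at hlim
  exact le_of_tendsto hlim (mem_of_superset (Ioo_mem_nhdsLT one_pos) hscaled)

theorem mul_iff (hp : 1 ≤ p) (hG : ContinuousOn G (closedBall 0 1))
    (hG1 : ∀ z ∈ sphere (0 : ℂ) 1, ‖G z‖ = 1) (hG2 : ∀ z ∈ ball (0 : ℂ) 1, ‖G z‖ ≤ 1)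
    (hF : DifferentiableOn ℂ F (ball 0 1)) :
    CircleMeansLE p (fun z => G z * F z) C ↔ CircleMeansLE p F C := by
  refine ⟨of_mul hp hG (fun z hz => (hG1 z hz).ge) hF, fun hC r hr => ?_⟩
  have hGc := hG.mono (sphere_subset_closedBall.trans (closedBall_subset_closedBall hr.2.le))
  have hFc := hF.continuousOn.mono (sphere_subset_ball hr.2)
  have hp0 : 0 ≤ p := by linarith
  refine (Real.circleAverage_mono (ContinuousOn.circleIntegrable hr.1.le
    ((hGc.mul hFc).norm.rpow_const fun _ _ => Or.inr hp0)) (ContinuousOn.circleIntegrable hr.1.le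
    (hFc.norm.rpow_const fun _ _ => Or.inr hp0)) fun z hz => ?_).trans (hC r hr)
  rw [Pi.mul_apply, norm_mul]
  gcongr
  exact mul_le_of_le_one_left (norm_nonneg _) (hG2 z (mem_ball_of_mem_sphere_abs hr hz))

theorem norm_zero_rpow_le (hp : 1 ≤ p) (hF : DifferentiableOn ℂ F (ball 0 1))
    (hC : CircleMeansLE p F C) : ‖F 0‖ ^ p ≤ C :=
  (norm_center_rpow_le_circleAverage hp one_half_pos
    (hF.diffContOnCl_ball (closedBall_subset_ball one_half_lt_one))).trans
    (hC (1 / 2) ⟨one_half_pos, one_half_lt_one⟩)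

-- Transport the estimate at the origin by the automorphism `w ↦ (w + z) / (1 + conj z * w)`.
theorem one_sub_norm_sq_mul_norm_rpow_le (hp : 1 ≤ p) (hF : DifferentiableOn ℂ F (ball 0 1))
    (hC : CircleMeansLE p F C) (z : 𝔻) : (1 - ‖(z : ℂ)‖ ^ 2) * ‖F z‖ ^ p ≤ C := by
  let τ : DiscAut := ⟨1, -z, norm_one, by simpa using z.norm_lt_one⟩
  have hτ0 : τ.formula 0 = z := by simp [τ, DiscAut.formula]
  have hτ1 : ‖deriv τ.formula 0‖ = 1 - ‖(z : ℂ)‖ ^ 2 := by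
    simpa [hτ0] using (τ.one_sub_norm_formula_sq (z := 0) (by simp)).symm
  have h := (hC.weight_mul_comp hp τ hF).norm_zero_rpow_le hp
    (τ.differentiableOn_weight_mul_comp p hF)
  rwa [norm_mul, Real.mul_rpow (norm_nonneg _) (norm_nonneg _), τ.norm_weight_rpow (by linarith),
    hτ0, hτ1] at h

end CircleMeansLE

/-! ### The operator `M_ψ U_φ` on the Hardy space -/

theorem eqOn_discExtend {f : 𝔻 → ℂ} {F : ℂ → ℂ} (h : ∀ z : 𝔻, f z = F z) :
    EqOn (discExtend f) F (ball 0 1) := fun z hz => by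
  lift z to 𝔻 using mem_ball_zero_iff.mp hz
  rw [discExtend_coe, h]

theorem isDiscHolomorphic_of_differentiableOn {f : 𝔻 → ℂ} {F : ℂ → ℂ} (h : ∀ z : 𝔻, f z = F z)
    (hF : DifferentiableOn ℂ F (ball 0 1)) : IsDiscHolomorphic f :=
  hF.congr (eqOn_discExtend h)

theorem hardyMean_le_iff {p : ℝ} (hp : 1 ≤ p) {f : 𝔻 → ℂ} {r C : ℝ} (hC : 0 ≤ C) :
    hardyMean p f r ≤ C ↔ Real.circleAverage (fun z => ‖discExtend f z‖ ^ p) 0 r ≤ C ^ p := by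
  rw [hardyMean, one_div]
  exact Real.rpow_inv_le_iff_of_pos
    (Real.circleAverage_nonneg_of_nonneg fun _ _ => by positivity) hC (by linarith)

section HardySpace

variable {p : ℝ} [Fact (1 ≤ p)]

theorem mem_hardySubmodule_iff {f : 𝔻 → ℂ} :
    f ∈ hardySubmodule p ↔
      IsDiscHolomorphic f ∧ ∃ C, 0 ≤ C ∧ CircleMeansLE p (discExtend f) (C ^ p) := by
  refine and_congr_right fun _ => ⟨fun ⟨C, hC⟩ => ?_, fun ⟨C, hC0, hC⟩ => ⟨C, ?_⟩⟩
  · have hle : ∀ r ∈ Ioo (0 : ℝ) 1, hardyMean p f r ≤ max C 0 := fun r hr =>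
      (hC (mem_image_of_mem _ hr)).trans (le_max_left _ _)
    exact ⟨max C 0, le_max_right _ _, fun r hr =>
      (hardyMean_le_iff Fact.out (le_max_right _ _)).mp (hle r hr)⟩
  · rintro _ ⟨r, hr, rfl⟩
    exact (hardyMean_le_iff Fact.out hC0).mpr (hC r hr)

theorem HardySpace.norm_le_iff (f : HardySpace p) {C : ℝ} :
    ‖f‖ ≤ C ↔ 0 ≤ C ∧ CircleMeansLE p (discExtend f) (C ^ p) :=
  ⟨fun h => have hC := (norm_nonneg f).trans h
    ⟨hC, fun _ hr => (hardyMean_le_iff Fact.out hC).mp ((f.hardyMean_le_norm hr).trans h)⟩,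
   fun ⟨hC, h⟩ => f.norm_le_of_forall fun r hr => (hardyMean_le_iff Fact.out hC).mpr (h r hr)⟩

theorem const_mem_hardySubmodule (c : ℂ) : (fun _ : 𝔻 => c) ∈ hardySubmodule p := by
  refine mem_hardySubmodule_iff.mpr ⟨isDiscHolomorphic_of_differentiableOn (F := fun _ => c)
    (fun _ => rfl) (differentiableOn_const c), ‖c‖, norm_nonneg c, ?_⟩
  refine (CircleMeansLE.congr (G := fun _ => c) fun z hz => ?_).mpr fun r _ => ?_
  · rw [eqOn_discExtend (F := fun _ => c) (fun _ => rfl) hz]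
  · rw [Real.circleAverage_const]

/-- Point evaluation on the Hardy space. -/
def HardySpace.eval (p : ℝ) [Fact (1 ≤ p)] (z : 𝔻) : HardySpace p →ₗ[ℂ] ℂ :=
  LinearMap.proj z ∘ₗ HardySpace.toFun

theorem HardySpace.eval_apply (z : 𝔻) (f : HardySpace p) : HardySpace.eval p z f = f z := rfl

theorem HardySpace.eval_surjective (z : 𝔻) : Surjective (HardySpace.eval p z) :=
  fun c => ⟨⟨_, const_mem_hardySubmodule c⟩, rfl⟩

theorem HardySpace.one_sub_norm_sq_mul_norm_rpow_le (f : HardySpace p) (z : 𝔻) :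
    (1 - ‖(z : ℂ)‖ ^ 2) * ‖f z‖ ^ p ≤ ‖f‖ ^ p := by
  rw [← discExtend_coe (f : 𝔻 → ℂ) z]
  exact (f.norm_le_iff.mp le_rfl).2.one_sub_norm_sq_mul_norm_rpow_le Fact.out f.2.1 z

end HardySpace

/-- The operator `M_ψ U_φ` on arbitrary functions on the disc. -/
def mulForelli (p : ℝ) (φ ψ : DiscAut) : (𝔻 → ℂ) →ₗ[ℂ] (𝔻 → ℂ) :=
  mulOp (fun z => (ψ z : ℂ)) ∘ₗ forelliOp p φ

section mulForelli

variable {p C : ℝ} (φ ψ : DiscAut) {f g : 𝔻 → ℂ}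

theorem mulForelli_apply (p : ℝ) (f : 𝔻 → ℂ) (z : 𝔻) :
    mulForelli p φ ψ f z = ψ z * (φ.weight p z * f (φ z)) := rfl

theorem mulForelli_apply_eq_formula_mul (p : ℝ) (f : 𝔻 → ℂ) (z : 𝔻) :
    mulForelli p φ ψ f z =
      ψ.formula z * (φ.weight p z * discExtend f (φ.formula z)) := by
  rw [mulForelli_apply, ← φ.coe_apply, discExtend_coe, ψ.coe_apply]

theorem IsDiscHolomorphic.mulForelli (p : ℝ) (hf : IsDiscHolomorphic f) :
    IsDiscHolomorphic (mulForelli p φ ψ f) :=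
  isDiscHolomorphic_of_differentiableOn (mulForelli_apply_eq_formula_mul φ ψ p f)
    ((ψ.differentiableOn_formula.mono ball_subset_closedBall).mul
      (φ.differentiableOn_weight_mul_comp p hf))

theorem circleMeansLE_mulForelli_iff (hp : 1 ≤ p) (hf : IsDiscHolomorphic f) :
    CircleMeansLE p (discExtend (mulForelli p φ ψ f)) C ↔ CircleMeansLE p (discExtend f) C := by
  let G : ℂ → ℂ := fun z => ψ.formula z * (φ.weight p z * discExtend f (φ.formula z))
  have hG : EqOn (discExtend (mulForelli p φ ψ f)) G (ball 0 1) :=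
    eqOn_discExtend (mulForelli_apply_eq_formula_mul φ ψ p f)
  rw [CircleMeansLE.congr fun z hz => congrArg norm (hG hz),
    CircleMeansLE.mul_iff hp ψ.differentiableOn_formula.continuousOn
      (fun z hz => ψ.norm_formula_eq_one (mem_sphere_zero_iff_norm.mp hz))
      (fun z hz => ψ.norm_formula_le_one (mem_ball_zero_iff.mp hz).le)
      (φ.differentiableOn_weight_mul_comp p hf),
    CircleMeansLE.weight_mul_comp_iff hp φ hf]

theorem mulForelli_mem_hardySubmodule_iff [Fact (1 ≤ p)] (hf : IsDiscHolomorphic f) :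
    mulForelli p φ ψ f ∈ hardySubmodule p ↔ f ∈ hardySubmodule p := by
  simp only [mem_hardySubmodule_iff, circleMeansLE_mulForelli_iff φ ψ Fact.out hf, hf,
    hf.mulForelli φ ψ p]

end mulForelli

theorem DiscAut.exists_formula_mul_eq (ψ : DiscAut) {G : ℂ → ℂ}
    (hG : DifferentiableOn ℂ G (ball 0 1)) (hGa : G ψ.a = 0) :
    ∃ Q, DifferentiableOn ℂ Q (ball 0 1) ∧ ∀ z ∈ ball (0 : ℂ) 1, ψ.formula z * Q z = G z := by
  have ha : ball (0 : ℂ) 1 ∈ 𝓝 ψ.a := isOpen_ball.mem_nhds (mem_ball_zero_iff.mpr ψ.norm_a)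
  refine ⟨fun z => conj ψ.lam * (1 - conj ψ.a * z) * dslope G ψ.a z,
    DifferentiableOn.mul (by fun_prop) ((Complex.differentiableOn_dslope ha).mpr hG),
    fun z hz => ?_⟩
  have hslope : (z - ψ.a) * dslope G ψ.a z = G z := by
    simpa [hGa] using sub_smul_dslope G ψ.a z
  rw [formula, div_mul_eq_mul_div,
    div_eq_iff (one_sub_conj_mul_ne_zero ψ.norm_a (mem_ball_zero_iff.mp hz).le), ← hslope]
  linear_combination ((z - ψ.a) * (1 - conj ψ.a * z) * dslope G ψ.a z) *
    conj_mul_self_of_norm_eq_one ψ.norm_lam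

theorem DiscAut.exists_weight_mul_comp_eq (φ : DiscAut) (p : ℝ) {G : ℂ → ℂ}
    (hG : DifferentiableOn ℂ G (ball 0 1)) :
    ∃ F, DifferentiableOn ℂ F (ball 0 1) ∧
      ∀ z ∈ ball (0 : ℂ) 1, φ.weight p z * F (φ.formula z) = G z := by
  refine ⟨fun z => (G / φ.weight p) (φ.inv.formula z), ?_, fun z hz => ?_⟩
  · refine DifferentiableOn.comp (hG.div ((φ.differentiableOn_weight p).mono
      ball_subset_closedBall) fun z hz => φ.weight_ne_zero p (mem_ball_zero_iff.mp hz).le)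
      (φ.inv.differentiableOn_formula.mono ball_subset_closedBall) φ.inv.mapsTo_formula
  · have hz := (mem_ball_zero_iff.mp hz).le
    simp only [Pi.div_apply, φ.inv_formula_formula hz]
    exact mul_div_cancel₀ _ (φ.weight_ne_zero p hz)

theorem exists_mulForelli_eq (p : ℝ) (φ ψ : DiscAut) {g : 𝔻 → ℂ} (hg : IsDiscHolomorphic g)
    (hgψ : g ψ.zero = 0) : ∃ f, IsDiscHolomorphic f ∧ mulForelli p φ ψ f = g := by
  obtain ⟨Q, hQ, hQg⟩ := ψ.exists_formula_mul_eq hg ((discExtend_coe g ψ.zero).trans hgψ)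
  obtain ⟨F, hF, hFQ⟩ := φ.exists_weight_mul_comp_eq p hQ
  refine ⟨fun z => F z, isDiscHolomorphic_of_differentiableOn (fun _ => rfl) hF, funext fun z => ?_⟩
  have hz : (z : ℂ) ∈ ball (0 : ℂ) 1 := mem_ball_zero_iff.mpr z.norm_lt_one
  rw [mulForelli_apply, φ.coe_apply, hFQ z hz, ψ.coe_apply, hQg z hz, discExtend_coe]

section mulForelliHardy

variable (p : ℝ) [Fact (1 ≤ p)] (φ ψ : DiscAut)

/-- The operator `M_ψ U_φ` on the Hardy space, as a linear isometry. -/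
def mulForelliHardy : HardySpace p →ₗᵢ[ℂ] HardySpace p where
  toLinearMap := LinearMap.restrict (p := hardySubmodule p) (q := hardySubmodule p)
    (mulForelli p φ ψ) fun _ hf => (mulForelli_mem_hardySubmodule_iff φ ψ hf.1).mpr hf
  norm_map' f := eq_of_forall_ge_iff fun C => by
    rw [HardySpace.norm_le_iff, HardySpace.norm_le_iff]
    exact and_congr_right' (circleMeansLE_mulForelli_iff φ ψ Fact.out f.2.1)

theorem mulForelliHardy_apply (f : HardySpace p) (z : 𝔻) :
    mulForelliHardy p φ ψ f z = ψ z * (φ.weight p z * f (φ z)) := rfl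

theorem range_mulForelliHardy :
    LinearMap.range (mulForelliHardy p φ ψ).toLinearMap =
      LinearMap.ker (HardySpace.eval p ψ.zero) := by
  ext g
  rw [LinearMap.mem_ker, LinearMap.mem_range, HardySpace.eval_apply]
  constructor
  · rintro ⟨f, rfl⟩
    exact mul_eq_zero_of_left (Complex.UnitDisc.coe_eq_zero.mpr (ψ.apply_eq_zero_iff.mpr rfl)) _
  · intro hg
    obtain ⟨f, hf, hfg⟩ := exists_mulForelli_eq p φ ψ g.2.1 hg
    have hmem : f ∈ hardySubmodule p :=
      (mulForelli_mem_hardySubmodule_iff φ ψ hf).mp (hfg ▸ g.2)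
    exact ⟨⟨f, hmem⟩, Subtype.ext hfg⟩

theorem finrank_quotient_range_mulForelliHardy :
    Module.finrank ℂ (HardySpace p ⧸ LinearMap.range (mulForelliHardy p φ ψ).toLinearMap) = 1 := by
  rw [range_mulForelliHardy, (LinearMap.quotKerEquivOfSurjective _
    (HardySpace.eval_surjective ψ.zero)).finrank_eq, Module.finrank_self]

/-! ### Powers of `M_ψ U_φ` -/

variable {p}

theorem one_sub_norm_sq_mul_norm_mulForelliHardy_rpow (f : HardySpace p) (z : 𝔻) :
    (1 - ‖(z : ℂ)‖ ^ 2) * ‖mulForelliHardy p φ ψ f z‖ ^ p =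
      ‖(ψ z : ℂ)‖ ^ p * ((1 - ‖(φ z : ℂ)‖ ^ 2) * ‖f (φ z)‖ ^ p) := by
  have hp : p ≠ 0 := (zero_lt_one.trans_le Fact.out).ne'
  rw [mulForelliHardy_apply, norm_mul, norm_mul, Real.mul_rpow (norm_nonneg _) (by positivity),
    Real.mul_rpow (norm_nonneg _) (norm_nonneg _), φ.norm_weight_rpow hp, φ.coe_apply,
    φ.one_sub_norm_formula_sq z.norm_lt_one.le]
  ring

theorem one_sub_norm_sq_mul_norm_mulForelliHardy_iterate_rpow (f : HardySpace p) (n : ℕ) (z : 𝔻) :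
    (1 - ‖(z : ℂ)‖ ^ 2) * ‖(mulForelliHardy p φ ψ)^[n] f z‖ ^ p =
      (∏ k ∈ Finset.range n, ‖(ψ (φ^[k] z) : ℂ)‖) ^ p *
        ((1 - ‖(φ^[n] z : ℂ)‖ ^ 2) * ‖f (φ^[n] z)‖ ^ p) := by
  induction n generalizing z with
  | zero => simp
  | succ n ih =>
    rw [iterate_succ_apply', one_sub_norm_sq_mul_norm_mulForelliHardy_rpow, ih,
      Finset.prod_range_succ', Real.mul_rpow (Finset.prod_nonneg fun _ _ => norm_nonneg _)
        (norm_nonneg _)]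
    simp only [iterate_succ_apply, iterate_zero_apply]
    ring

theorem one_sub_norm_sq_mul_norm_mulForelliHardy_iterate_rpow_le (f : HardySpace p) (n : ℕ)
    (z : 𝔻) :
    (1 - ‖(z : ℂ)‖ ^ 2) * ‖(mulForelliHardy p φ ψ)^[n] f z‖ ^ p ≤
      (∏ k ∈ Finset.range n, ‖(ψ (φ^[k] z) : ℂ)‖) ^ p *
        ‖(mulForelliHardy p φ ψ)^[n] f‖ ^ p := by
  have hnorm : ‖(mulForelliHardy p φ ψ)^[n] f‖ = ‖f‖ := by
    induction n with
    | zero => rfl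
    | succ n ih => rw [iterate_succ_apply', LinearIsometry.norm_map, ih]
  rw [one_sub_norm_sq_mul_norm_mulForelliHardy_iterate_rpow, hnorm]
  gcongr
  exact f.one_sub_norm_sq_mul_norm_rpow_le _

variable {φ ψ}

theorem eq_zero_of_forall_mem_range_mulForelliHardy_iterate
    (hprod : ∀ z, Tendsto (fun n => ∏ k ∈ Finset.range n, ‖(ψ (φ^[k] z) : ℂ)‖) atTop (𝓝 0))
    {g : HardySpace p} (hg : ∀ n, 1 ≤ n → g ∈ range (mulForelliHardy p φ ψ)^[n]) : g = 0 := by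
  have hp : 0 < p := zero_lt_one.trans_le Fact.out
  refine Subtype.ext (funext fun z => ?_)
  have hle : ∀ n, 1 ≤ n → (1 - ‖(z : ℂ)‖ ^ 2) * ‖g z‖ ^ p ≤
      (∏ k ∈ Finset.range n, ‖(ψ (φ^[k] z) : ℂ)‖) ^ p * ‖g‖ ^ p := fun n hn => by
    obtain ⟨f, rfl⟩ := hg n hn
    exact one_sub_norm_sq_mul_norm_mulForelliHardy_iterate_rpow_le φ ψ f n z
  have hlim : Tendsto (fun n => (∏ k ∈ Finset.range n, ‖(ψ (φ^[k] z) : ℂ)‖) ^ p * ‖g‖ ^ p)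
      atTop (𝓝 0) := by
    simpa [Real.zero_rpow hp.ne'] using
      ((hprod z).rpow_const (Or.inr hp.le)).mul_const (‖g‖ ^ p)
  have hnonpos := ge_of_tendsto hlim (eventually_atTop.mpr ⟨1, hle⟩)
  have hz : 0 < 1 - ‖(z : ℂ)‖ ^ 2 := sub_pos.mpr z.sq_norm_lt_one
  have hpow := (nonpos_of_mul_nonpos_right hnonpos hz).antisymm (by positivity)
  exact norm_eq_zero.mp ((Real.rpow_eq_zero (norm_nonneg _) hp.ne').mp hpow)

theorem isCrownover_mulForelliHardy
    (hprod : ∀ z, Tendsto (fun n => ∏ k ∈ Finset.range n, ‖(ψ (φ^[k] z) : ℂ)‖) atTop (𝓝 0)) :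
    IsCrownover (mulForelliHardy p φ ψ).toContinuousLinearMap where
  isometry := (mulForelliHardy p φ ψ).isometry
  codim_one := finrank_quotient_range_mulForelliHardy p φ ψ
  iInter_range := by
    refine eq_singleton_iff_unique_mem.mpr ⟨mem_iInter₂.mpr fun n _ => ⟨0, map_zero _⟩,
      fun g hg => eq_zero_of_forall_mem_range_mulForelliHardy_iterate hprod fun n hn => ?_⟩
    simpa only [FunLike.coe_pow_eq_iterate,
      LinearIsometry.coe_toContinuousLinearMap] using mem_iInter₂.mp hg n hn

end mulForelliHardy

/-! ### Orbits of automorphisms with a fixed point -/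

theorem pseudohyperbolicDist_lt_one {z q : ℂ} (hz : ‖z‖ < 1) (hq : ‖q‖ < 1) :
    pseudohyperbolicDist z q < 1 := by
  have hpos : 0 < (1 - ‖q‖ ^ 2) * (1 - ‖z‖ ^ 2) :=
    mul_pos (sub_pos.mpr (pow_lt_one₀ (norm_nonneg q) hq two_ne_zero))
      (sub_pos.mpr (pow_lt_one₀ (norm_nonneg z) hz two_ne_zero))
  rw [pseudohyperbolicDist,
    div_lt_one (norm_pos_iff.mpr (one_sub_conj_mul_ne_zero hq hz.le))]
  rw [← norm_one_sub_conj_mul_sq_sub, sub_pos] at hpos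
  exact lt_of_pow_lt_pow_left₀ 2 (norm_nonneg _) hpos

theorem pseudohyperbolicDist_pos {z q : ℂ} (hz : ‖z‖ < 1) (hq : ‖q‖ < 1) (hne : z ≠ q) :
    0 < pseudohyperbolicDist z q :=
  div_pos (norm_pos_iff.mpr (sub_ne_zero.mpr hne))
    (norm_pos_iff.mpr (one_sub_conj_mul_ne_zero hq hz.le))

theorem norm_smul_sub_smul_sq_sub (s : ℝ) (z q : ℂ) :
    ‖(1 - s ^ 2 * ‖q‖ ^ 2) • z - (1 - s ^ 2) • q‖ ^ 2 - (s * (1 - ‖q‖ ^ 2)) ^ 2 =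
      (1 - s ^ 2 * ‖q‖ ^ 2) * (‖z - q‖ ^ 2 - s ^ 2 * ‖1 - conj q * z‖ ^ 2) := by
  simp only [Complex.real_smul, ← Complex.normSq_eq_norm_sq, Complex.normSq_apply, Complex.sub_re,
    Complex.sub_im, Complex.mul_re, Complex.mul_im, Complex.conj_re, Complex.conj_im,
    Complex.one_re, Complex.one_im, Complex.ofReal_re, Complex.ofReal_im]
  ring

/-- The Euclidean centre of the pseudohyperbolic circle of radius `s` about `q`. -/
def pseudohyperbolicCenter (q : ℂ) (s : ℝ) : ℂ := ((1 - s ^ 2) / (1 - s ^ 2 * ‖q‖ ^ 2)) • q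

/-- The Euclidean radius of the pseudohyperbolic circle of radius `s` about `q`. -/
def pseudohyperbolicRadius (q : ℂ) (s : ℝ) : ℝ := s * (1 - ‖q‖ ^ 2) / (1 - s ^ 2 * ‖q‖ ^ 2)

section pseudohyperbolicCircle

variable {q z : ℂ} {s : ℝ}

theorem one_sub_sq_mul_norm_sq_pos (hq : ‖q‖ < 1) (hs0 : 0 ≤ s) (hs1 : s < 1) :
    0 < 1 - s ^ 2 * ‖q‖ ^ 2 := by
  rw [← mul_pow, sub_pos]
  exact pow_lt_one₀ (by positivity) (mul_lt_one_of_nonneg_of_lt_one_left hs0 hs1 hq.le) two_ne_zero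

theorem pseudohyperbolicRadius_pos (hq : ‖q‖ < 1) (hs0 : 0 < s) (hs1 : s < 1) :
    0 < pseudohyperbolicRadius q s :=
  div_pos (mul_pos hs0 (sub_pos.mpr (pow_lt_one₀ (norm_nonneg q) hq two_ne_zero)))
    (one_sub_sq_mul_norm_sq_pos hq hs0.le hs1)

theorem norm_pseudohyperbolicCenter_add_radius_lt_one (hq : ‖q‖ < 1) (hs0 : 0 ≤ s) (hs1 : s < 1) :
    ‖pseudohyperbolicCenter q s‖ + pseudohyperbolicRadius q s < 1 := by
  have hD := one_sub_sq_mul_norm_sq_pos hq hs0 hs1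
  have hsq : 0 < 1 - s * ‖q‖ :=
    sub_pos.mpr (mul_lt_one_of_nonneg_of_lt_one_left hs0 hs1 hq.le)
  have hs2 : 0 ≤ 1 - s ^ 2 := sub_nonneg.mpr (pow_le_one₀ hs0 hs1.le)
  rw [pseudohyperbolicCenter, pseudohyperbolicRadius, norm_smul,
    Real.norm_of_nonneg (by positivity), div_mul_eq_mul_div, ← add_div, div_lt_one hD]
  linear_combination mul_pos (mul_pos (sub_pos.mpr hq) (sub_pos.mpr hs1)) hsq

theorem norm_sub_pseudohyperbolicCenter (hq : ‖q‖ < 1) (hz : ‖z‖ < 1) :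
    ‖z - pseudohyperbolicCenter q (pseudohyperbolicDist z q)‖ =
      pseudohyperbolicRadius q (pseudohyperbolicDist z q) := by
  have hdist : ‖z - q‖ = pseudohyperbolicDist z q * ‖1 - conj q * z‖ :=
    (div_mul_cancel₀ _ (norm_ne_zero_iff.mpr (one_sub_conj_mul_ne_zero hq hz.le))).symm
  have hs0 : 0 ≤ pseudohyperbolicDist z q := by unfold pseudohyperbolicDist; positivity
  have hD := one_sub_sq_mul_norm_sq_pos hq hs0 (pseudohyperbolicDist_lt_one hz hq)
  have hq2 : 0 ≤ 1 - ‖q‖ ^ 2 := sub_nonneg.mpr (pow_le_one₀ (norm_nonneg q) hq.le)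
  generalize pseudohyperbolicDist z q = s at *
  have hscaled : ‖(1 - s ^ 2 * ‖q‖ ^ 2) • z - (1 - s ^ 2) • q‖ = s * (1 - ‖q‖ ^ 2) := by
    refine (sq_eq_sq₀ (norm_nonneg _) (by positivity)).mp (sub_eq_zero.mp ?_)
    rw [norm_smul_sub_smul_sq_sub, hdist, mul_pow, sub_self, mul_zero]
  have hcenter : z - pseudohyperbolicCenter q s =
      (1 - s ^ 2 * ‖q‖ ^ 2)⁻¹ • ((1 - s ^ 2 * ‖q‖ ^ 2) • z - (1 - s ^ 2) • q) := by
    rw [smul_sub, inv_smul_smul₀ hD.ne', smul_smul, pseudohyperbolicCenter, inv_mul_eq_div]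
  rw [hcenter, norm_smul, hscaled, norm_inv, Real.norm_of_nonneg hD.le, inv_mul_eq_div,
    pseudohyperbolicRadius]

end pseudohyperbolicCircle

theorem closedBall_subset_ball_zero_one {c : ℂ} {R : ℝ} (h : ‖c‖ + R < 1) :
    closedBall c R ⊆ ball 0 1 := by
  refine closedBall_subset_ball' ?_
  rwa [dist_zero_right, add_comm]

namespace DiscAut

variable {φ : DiscAut} {q : 𝔻}

theorem pseudohyperbolicDist_iterate_of_fixed (hq : φ q = q) (n : ℕ) (z : 𝔻) :
    pseudohyperbolicDist (φ^[n] z : 𝔻) q = pseudohyperbolicDist z q := by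
  induction n with
  | zero => rfl
  | succ n ih =>
    have h := φ.pseudohyperbolicDist_formula (φ^[n] z).norm_lt_one.le q.norm_lt_one.le
    rwa [← φ.coe_apply, ← φ.coe_apply, hq, ← iterate_succ_apply' (⇑φ), ih] at h

theorem inv_apply_of_fixed (hq : φ q = q) : φ.inv q = q := by
  simpa only [hq] using φ.leftInverse_inv q

theorem exists_sphere_iterate (hq : φ q = q) (b : 𝔻) :
    ∃ (c : ℂ) (R : ℝ), 0 < R ∧ ‖c‖ + R < 1 ∧ ∀ n, (φ^[n] b : ℂ) ∈ sphere c R := by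
  rcases eq_or_ne b q with rfl | hne
  · have hb : 0 < (1 - ‖(b : ℂ)‖) / 3 := div_pos (sub_pos.mpr b.norm_lt_one) three_pos
    have hnorm : ‖(((1 - ‖(b : ℂ)‖) / 3 : ℝ) : ℂ)‖ = (1 - ‖(b : ℂ)‖) / 3 :=
      Complex.norm_of_nonneg hb.le
    refine ⟨b + ((1 - ‖(b : ℂ)‖) / 3 : ℝ), (1 - ‖(b : ℂ)‖) / 3, hb, ?_, fun n => ?_⟩
    · linarith [norm_add_le (b : ℂ) ((1 - ‖(b : ℂ)‖) / 3 : ℝ)]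
    · rw [iterate_fixed hq, mem_sphere_iff_norm, sub_add_cancel_left, norm_neg, hnorm]
  · have hs0 := pseudohyperbolicDist_pos b.norm_lt_one q.norm_lt_one
      (Complex.UnitDisc.coe_injective.ne hne)
    have hs1 := pseudohyperbolicDist_lt_one b.norm_lt_one q.norm_lt_one
    refine ⟨_, _, pseudohyperbolicRadius_pos q.norm_lt_one hs0 hs1,
      norm_pseudohyperbolicCenter_add_radius_lt_one q.norm_lt_one hs0.le hs1, fun n => ?_⟩
    rw [mem_sphere_iff_norm, ← pseudohyperbolicDist_iterate_of_fixed hq n b]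
    exact norm_sub_pseudohyperbolicCenter q.norm_lt_one (φ^[n] b).norm_lt_one

theorem exists_norm_apply_le (ψ : DiscAut) {K : Set ℂ} (hK : IsCompact K) (hK1 : K ⊆ ball 0 1) :
    ∃ δ, 0 ≤ δ ∧ δ < 1 ∧ ∀ z : 𝔻, (z : ℂ) ∈ K → ‖(ψ z : ℂ)‖ ≤ δ := by
  rcases K.eq_empty_or_nonempty with rfl | hne
  · exact ⟨0, le_rfl, one_pos, fun _ h => h.elim⟩
  · have hcont : ContinuousOn (fun z => ‖ψ.formula z‖) K :=
      (ψ.differentiableOn_formula.continuousOn.mono (hK1.trans ball_subset_closedBall)).norm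
    obtain ⟨x, hx, hmax⟩ := hK.exists_isMaxOn hne hcont
    exact ⟨‖ψ.formula x‖, norm_nonneg _,
      ψ.norm_formula_lt_one (mem_ball_zero_iff.mp (hK1 hx)), fun z hz => hmax hz⟩

theorem tendsto_prod_norm_apply_iterate_of_fixed (hq : φ q = q) (ψ : DiscAut) (z : 𝔻) :
    Tendsto (fun n => ∏ k ∈ Finset.range n, ‖(ψ (φ^[k] z) : ℂ)‖) atTop (𝓝 0) := by
  obtain ⟨c, R, -, hcR, horbit⟩ := exists_sphere_iterate hq z
  obtain ⟨δ, hδ0, hδ1, hδ⟩ := ψ.exists_norm_apply_le (isCompact_closedBall c R)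
    (closedBall_subset_ball_zero_one hcR)
  refine squeeze_zero (fun n => Finset.prod_nonneg fun _ _ => norm_nonneg _) (fun n => ?_)
    (tendsto_pow_atTop_nhds_zero_of_lt_one hδ0 hδ1)
  calc ∏ k ∈ Finset.range n, ‖(ψ (φ^[k] z) : ℂ)‖
      ≤ ∏ _k ∈ Finset.range n, δ := Finset.prod_le_prod (fun _ _ => norm_nonneg _)
        fun k _ => hδ _ (sphere_subset_closedBall (horbit k))
    _ = δ ^ n := by rw [Finset.prod_const, Finset.card_range]

theorem apply_iterate_eq_zero_iff (φ ψ : DiscAut) (n : ℕ) (z : 𝔻) :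
    ψ (φ^[n] z) = 0 ↔ z = φ.inv^[n] ψ.zero := by
  rw [ψ.apply_eq_zero_iff]
  exact ⟨fun h => h ▸ (φ.leftInverse_inv.iterate n z).symm,
    fun h => h ▸ φ.rightInverse_inv.iterate n ψ.zero⟩

end DiscAut

theorem not_summable_one_sub_norm {a : ℕ → 𝔻} {c : ℂ} {R : ℝ} (hcR : ‖c‖ + R < 1)
    (h : ∀ n, (a n : ℂ) ∈ sphere c R) : ¬ Summable fun n => 1 - ‖(a n : ℂ)‖ := by
  intro hsum
  have hle : ∀ n, 1 - (‖c‖ + R) ≤ 1 - ‖(a n : ℂ)‖ := fun n => by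
    linarith [norm_le_norm_add_norm_sub' (a n : ℂ) c, mem_sphere_iff_norm.mp (h n)]
  linarith [ge_of_tendsto' hsum.tendsto_atTop_zero hle]

theorem proposition3_general {p : ℝ} [Fact (1 ≤ p)] (φ ψ : DiscAut) (hφ : ∃ q : 𝔻, φ q = q) :
    (∃ S : HardySpace p →L[ℂ] HardySpace p,
      (∀ f : HardySpace p, (S f : 𝔻 → ℂ) = mulOp (fun z => (ψ z : ℂ)) (forelliOp p φ f)) ∧
        IsCrownover S) ∧
    ∃ a : ℕ → 𝔻, (∀ (n : ℕ) (z : 𝔻), ψ (φ^[n] z) = 0 ↔ z = a n) ∧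
      (∃ (c : ℂ) (R : ℝ), 0 < R ∧ closedBall c R ⊆ ball 0 1 ∧ ∀ n, (a n : ℂ) ∈ sphere c R) ∧
      ¬ Summable (fun n => 1 - ‖(a n : ℂ)‖) := by
  obtain ⟨q, hq⟩ := hφ
  obtain ⟨c, R, hR, hcR, horbit⟩ :=
    DiscAut.exists_sphere_iterate (DiscAut.inv_apply_of_fixed hq) ψ.zero
  exact ⟨⟨(mulForelliHardy p φ ψ).toContinuousLinearMap, fun _ => rfl,
      isCrownover_mulForelliHardy (DiscAut.tendsto_prod_norm_apply_iterate_of_fixed hq ψ)⟩,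
    fun n => φ.inv^[n] ψ.zero, φ.apply_iterate_eq_zero_iff ψ,
    ⟨c, R, hR, closedBall_subset_ball_zero_one hcR, horbit⟩,
    not_summable_one_sub_norm hcR horbit⟩

end

theorem proposition3 {p : ℝ} [Fact (1 ≤ p)] (hp2 : p ≠ 2) (φ ψ : DiscAut)
    (hφ : φ.IsElliptic) :
    (∃ S : HardySpace p →L[ℂ] HardySpace p,
      (∀ f : HardySpace p, (S f : 𝔻 → ℂ) = mulOp (fun z => (ψ z : ℂ)) (forelliOp p φ f)) ∧
        IsCrownover S) ∧
    ∃ a : ℕ → 𝔻, (∀ (n : ℕ) (z : 𝔻), ψ (φ^[n] z) = 0 ↔ z = a n) ∧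
      (∃ (c : ℂ) (R : ℝ), 0 < R ∧ closedBall c R ⊆ ball 0 1 ∧ ∀ n, (a n : ℂ) ∈ sphere c R) ∧
      ¬ Summable (fun n => 1 - ‖(a n : ℂ)‖) :=
  proposition3_general φ ψ hφ.2
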